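/- Let $m_0,m_1,m_2\in\mathbb{R}^2$ be three non-collinear points (receivers), labelled so that $\ast(d_{10}\wedge d_{20})>0$. Here $d_{ji}=m_j-m_i$, and for $v,w\in\mathbb{R}^2$ we put $\ast(v\wedge w)=v_1w_2-v_2w_1$ and $\ast v=(-v_2,v_1)^T$. Write $d_i(x)=x-m_i$ and, for $x\neq m_i$, $\tilde d_i(x)=d_i(x)/\|d_i(x)\|$. Define the reduced TDOA map $$\tau_2:\mathbb{R}^2\to\mathbb{R}^2,\qquad \tau_2(x)=\big(\|d_1(x)\|-\|d_0(x)\|,\ \|d_2(x)\|-\|d_0(x)\|\big)^T.$$ **In the $\tau$-plane.** Denote points by $\tau=(\tau_{10},\tau_{20})^T$, and let $$P_2=\{\tau : |\tau_{10}|\le\|d_{10}\|,\ |\tau_{20}|\le\|d_{20}\|,\ |\tau_{20}-\tau_{10}|\le\|d_{21}\|\},$$ with interior $\mathring P_2$ (given by the strict inequalities) and topological boundary $\partial P_2$. Put $$v(\tau)=\ast(\tau_{20}d_{10}-\tau_{10}d_{20}),\qquad l_0(\tau)=\frac{\ast\big((\|d_{20}\|^2-\tau_{20}^2)d_{10}-(\|d_{10}\|^2-\tau_{10}^2)d_{20}\big)}{2\ast(d_{10}\wedge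 d_{20})},$$ $$a=\|v\|^2-\ast(d_{10}\wedge d_{20})^2,\qquad b=\langle v,l_0\rangle,\qquad c=\|l_0\|^2.$$ Let $\alpha,\beta,\gamma$ be the angles between $d_{10},d_{20}$, between $d_{01},d_{21}$, and between $d_{02},d_{12}$, respectively, and define the affine functions $$\ell_0(\tau)=\|d_{20}\|\tau_{10}+\|d_{10}\|\tau_{20}-\|d_{10}\|\|d_{20}\|(1+\cos\alpha),$$ $$\ell_1(\tau)=-(\|d_{10}\|+\|d_{21}\|)\tau_{10}+\|d_{10}\|\tau_{20}-\|d_{10}\|\|d_{21}\|(1+\cos\beta),$$ $$\ell_2(\tau)=\|d_{20}\|\tau_{10}-(\|d_{20}\|+\|d_{21}\|)\tau_{20}-\|d_{20}\|\|d_{21}\|(1+\cos\gamma).$$ For $i=0,1,2$ let $U_i=\{\tau\in\mathring P_2 : a(\tau)>0,\ \ell_i(\tau)>0\}$. Finally let $$x_\pm(\tau)=m_0+l_0(\tau)+\lambda_\pm(\tau)\,v(\tau),\qquad \lambda_\pm=\frac{-b\pm\sqrt{b^2-ac}}{a}\quad (a\neq0),$$ so that $\lambda_\pm$ are the roots of $a\lambda^2+2b\lambda+c=0$;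 where $a(\tau)=0$, $\lambda_+$ means the root $-c/(2b)$ of the resulting linear equation $2b\lambda+c=0$. **In the $x$-plane.** For $x\notin\{m_0,m_1,m_2\}$ let $$J(x)=\ast\big(\tilde d_1(x)\wedge\tilde d_0(x)-\tilde d_2(x)\wedge\tilde d_0(x)+\tilde d_2(x)\wedge\tilde d_1(x)\big),$$ and define $$\Omega=\{x\in\mathbb{R}^2\setminus\{m_0,m_1,m_2\} : J(x)<0\},$$ $$\Omega_0=\{x : \ast(d_1(x)\wedge d_0(x))>0,\ \ast(d_2(x)\wedge d_0(x))<0\},$$ $$\Omega_1=\{x : \ast(d_1(x)\wedge d_0(x))>0,\ \ast(d_2(x)\wedge d_1(x))>0\},$$ $$\Omega_2=\{x : \ast(d_2(x)\wedge d_0(x))<0,\ \ast(d_2(x)\wedge d_1(x))>0\}.$$ The degeneracy locus $D$ is the union of the six closed half-lines $\{m_i+t(m_i-m_j) : t\ge0\}$, $i\ne j$. Then: 1. $\Omega,\Omega_0,\Omega_1,\Omega_2$ are open and pairwise disjoint, and their union is dense in $\mathbb{R}^2$. Moreover $\mathbb{R}^2\setminus(\Omega\cup\Omega_0\cup\Omega_1\cup\Omega_2)=D$,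 and $D$ consists of the three receivers together with the points $x\notin\{m_0,m_1,m_2\}$ at which the Jacobian matrix of $\tau_2$ has rank less than $2$, equivalently at which $J(x)=0$. 2. The restriction of $\tau_2$ to each of the four sets is differentiable and injective, with $\tau_2(\Omega)=\mathrm{Im}(\tau_2)\setminus\partial P_2$ and $\tau_2(\Omega_i)=U_i$ for $i=0,1,2$. Furthermore $(\tau_2|_\Omega)^{-1}=x_+$ on $\mathrm{Im}(\tau_2)\setminus\partial P_2$ and $(\tau_2|_{\Omega_i})^{-1}=x_-$ on $U_i$ for $i=0,1,2$. -/

import Mathlib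

namespace TDOA

noncomputable section

/-- The Euclidean plane (used both for the physical `x`-plane and for the `τ`-plane). -/
abbrev Plane : Type := EuclideanSpace ℝ (Fin 2)

/-- `∗(v ∧ w)`, the determinant of the matrix with columns `v`, `w`. -/
def wedge (v w : Plane) : ℝ := v 0 * w 1 - v 1 * w 0

/-- The Hodge operator on vectors: the counterclockwise rotation by `π / 2`. -/
def star (v : Plane) : Plane := !₂[-v 1, v 0]

/-- The unit vector `ṽ = v / ‖v‖` (used only for `v ≠ 0`). -/
def unit (v : Plane) : Plane := ‖v‖⁻¹ • v

variable (m : Fin 3 → Plane)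

/-- The displacement vector `d_i(x) = x - m_i`. -/
def disp (i : Fin 3) (x : Plane) : Plane := x - m i

/-- The displacement vector `d_{ji} = m_j - m_i` between two receivers. -/
def dd (j i : Fin 3) : Plane := m j - m i

/-- The range difference `τ_{ji}(x) = ‖d_j(x)‖ - ‖d_i(x)‖`. -/
def rangeDiff (j i : Fin 3) (x : Plane) : ℝ := ‖disp m j x‖ - ‖disp m i x‖

/-- The reduced TDOA map `τ₂(x) = (τ₁₀(x), τ₂₀(x))`. -/
def tau2 (x : Plane) : Plane := !₂[rangeDiff m 1 0 x, rangeDiff m 2 0 x]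

/-- `v(τ) = ∗(τ₂₀ d₁₀ - τ₁₀ d₂₀)`; the coordinates of `τ` are `τ 0 = τ₁₀` and `τ 1 = τ₂₀`. -/
def vVec (τ : Plane) : Plane := star (τ 1 • dd m 1 0 - τ 0 • dd m 2 0)

/-- `l₀(τ) = ∗((d₂₀² - τ₂₀²) d₁₀ - (d₁₀² - τ₁₀²) d₂₀) / (2 ∗(d₁₀ ∧ d₂₀))`. -/
def lVec (τ : Plane) : Plane :=
  (2 * wedge (dd m 1 0) (dd m 2 0))⁻¹ •
    star ((‖dd m 2 0‖ ^ 2 - τ 1 ^ 2) • dd m 1 0 - (‖dd m 1 0‖ ^ 2 - τ 0 ^ 2) • dd m 2 0)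

/-- `a(τ) = ‖v(τ)‖² - ∗(d₁₀ ∧ d₂₀)²`. -/
def aPoly (τ : Plane) : ℝ := ‖vVec m τ‖ ^ 2 - wedge (dd m 1 0) (dd m 2 0) ^ 2

/-- `b(τ) = ⟨v(τ), l₀(τ)⟩`. -/
def bPoly (τ : Plane) : ℝ := inner ℝ (vVec m τ) (lVec m τ)

/-- `c(τ) = ‖l₀(τ)‖²`. -/
def cPoly (τ : Plane) : ℝ := ‖lVec m τ‖ ^ 2

/-- The hexagon `P₂`. -/
def P2 : Set Plane :=
  {τ | (-‖dd m 1 0‖ ≤ τ 0 ∧ τ 0 ≤ ‖dd m 1 0‖) ∧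
       (-‖dd m 2 0‖ ≤ τ 1 ∧ τ 1 ≤ ‖dd m 2 0‖) ∧
       (-‖dd m 2 1‖ ≤ τ 1 - τ 0 ∧ τ 1 - τ 0 ≤ ‖dd m 2 1‖)}

/-- The interior of `P₂`, given by the strict inequalities. -/
def P2int : Set Plane :=
  {τ | (-‖dd m 1 0‖ < τ 0 ∧ τ 0 < ‖dd m 1 0‖) ∧
       (-‖dd m 2 0‖ < τ 1 ∧ τ 1 < ‖dd m 2 0‖) ∧
       (-‖dd m 2 1‖ < τ 1 - τ 0 ∧ τ 1 - τ 0 < ‖dd m 2 1‖)}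

/-- The angle `α` between `d₁₀` and `d₂₀`. -/
def angleα : ℝ := InnerProductGeometry.angle (dd m 1 0) (dd m 2 0)

/-- The angle `β` between `d₀₁` and `d₂₁`. -/
def angleβ : ℝ := InnerProductGeometry.angle (dd m 0 1) (dd m 2 1)

/-- The angle `γ` between `d₀₂` and `d₁₂`. -/
def angleγ : ℝ := InnerProductGeometry.angle (dd m 0 2) (dd m 1 2)

/-- The affine functions `l_0, l_1, l_2` defining the lines `L_0, L_1, L_2`. -/
def lineFun : Fin 3 → Plane → ℝ
  | 0, τ => ‖dd m 2 0‖ * τ 0 + ‖dd m 1 0‖ * τ 1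
      - ‖dd m 1 0‖ * ‖dd m 2 0‖ * (1 + Real.cos (angleα m))
  | 1, τ => -(‖dd m 1 0‖ + ‖dd m 2 1‖) * τ 0 + ‖dd m 1 0‖ * τ 1
      - ‖dd m 1 0‖ * ‖dd m 2 1‖ * (1 + Real.cos (angleβ m))
  | 2, τ => ‖dd m 2 0‖ * τ 0 - (‖dd m 2 0‖ + ‖dd m 2 1‖) * τ 1
      - ‖dd m 2 0‖ * ‖dd m 2 1‖ * (1 + Real.cos (angleγ m))

/-- The sets `U_i`, `i = 0, 1, 2`. -/
def U (i : Fin 3) : Set Plane := {τ | τ ∈ P2int m ∧ 0 < aPoly m τ ∧ 0 < lineFun m i τ}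

open Classical in
/-- The root `λ₊ = (-b + √(b² - a c)) / a` of `a λ² + 2 b λ + c = 0`. On the ellipse `a(τ) = 0`,
where this quotient is not defined, `λ₊` is the root `-c / (2 b)` of the equation `2 b λ + c = 0`;
for `b(τ) > 0` it is the limit of the quotient as `a → 0`. -/
def lambdaPlus (τ : Plane) : ℝ :=
  if aPoly m τ = 0 then -cPoly m τ / (2 * bPoly m τ)
  else (-bPoly m τ + Real.sqrt (bPoly m τ ^ 2 - aPoly m τ * cPoly m τ)) / aPoly m τ

/-- The root `λ₋ = (-b - √(b² - a c)) / a`, used only where `a(τ) > 0`. -/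
def lambdaMinus (τ : Plane) : ℝ :=
  (-bPoly m τ - Real.sqrt (bPoly m τ ^ 2 - aPoly m τ * cPoly m τ)) / aPoly m τ

/-- `x₊(τ) = m₀ + l₀(τ) + λ₊(τ) v(τ)`. -/
def xPlus (τ : Plane) : Plane := m 0 + lVec m τ + lambdaPlus m τ • vVec m τ

/-- `x₋(τ) = m₀ + l₀(τ) + λ₋(τ) v(τ)`. -/
def xMinus (τ : Plane) : Plane := m 0 + lVec m τ + lambdaMinus m τ • vVec m τ

/-- `∗(d̃₁(x) ∧ d̃₀(x) - d̃₂(x) ∧ d̃₀(x) + d̃₂(x) ∧ d̃₁(x))`, for `x` not a receiver. -/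
def unitWedge (x : Plane) : ℝ :=
  wedge (unit (disp m 1 x)) (unit (disp m 0 x))
    - wedge (unit (disp m 2 x)) (unit (disp m 0 x))
    + wedge (unit (disp m 2 x)) (unit (disp m 1 x))

/-- The set `Ω`. The receivers are excluded, since the unit vectors in the defining inequality
do not exist there. -/
def Omega : Set Plane := {x | (∀ i, x ≠ m i) ∧ unitWedge m x < 0}

/-- The sets `Ω_i`, `i = 0, 1, 2`. -/
def OmegaI : Fin 3 → Set Plane
  | 0 => {x | 0 < wedge (disp m 1 x) (disp m 0 x) ∧ wedge (disp m 2 x) (disp m 0 x) < 0}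
  | 1 => {x | 0 < wedge (disp m 1 x) (disp m 0 x) ∧ 0 < wedge (disp m 2 x) (disp m 1 x)}
  | 2 => {x | wedge (disp m 2 x) (disp m 0 x) < 0 ∧ 0 < wedge (disp m 2 x) (disp m 1 x)}

/-- The degeneracy locus `D`: the union of the six closed half-lines that start at a receiver
`m_i` and run away from another receiver `m_j` along the line through both. -/
def degeneracyLocus : Set Plane :=
  {x | ∃ i j : Fin 3, i ≠ j ∧ ∃ t : ℝ, 0 ≤ t ∧ x = m i + t • (m i - m j)}

end

end TDOA

namespace TDOA

/-! ### Coordinates in the plane, wedge products and unit vectors. -/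

section Plane

/-! Write W = ∗(d₁₀ ∧ d₂₀) > 0. Squaring ‖d_j(x)‖ = ‖d₀(x)‖ + τ_{j0} cancels ‖d₀(x)‖² and leaves two
equations linear in d₀(x) and ‖d₀(x)‖. Solving them gives d₀(x) = l₀ + r v with r = -‖d₀(x)‖ / W ≤
0, and the remaining relation between r and ‖d₀(x)‖ is a r² + 2 b r + c = 0. Over the interior of P₂
the fibre of τ₂ is therefore the set of nonpositive roots (`root_of_tau2`, `tau2_of_root`).

The choice of root is read off the Jacobian: a r + b = -‖d₀‖ ‖d₁‖ ‖d₂‖ J(x) (`deriv_at_root`). Thus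
J < 0 selects λ₊ and J > 0 selects λ₋, which gives both injectivity and the inverse formulas. The
sign of J is elementary geometry, as -J is twice the signed area of the triangle with vertices d̃₀,
d̃₁, d̃₂ on the unit circle. It vanishes when two vertices coincide, which describes D and also the
preimage of ∂P₂; J > 0 means that x lies in some Ω_i.

For the images, a point of Ω_i forces a > 0 and two negative roots, and the second root is a point
of Ω with the same range differences (`exists_mem_Omega_tau2_eq`). Moreover ℓ_i > 0 on τ₂(Ω_i), by
Cauchy–Schwarz and the strict triangle inequality (`line_lt_of_opposite_cone`). Conversely, on U_i
the roots have the same sign, and b > 0 must be shown. If b < 0, the symmetry τ ↦ -τ places -τ in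
the image of some Ω_j, so ℓ_j(-τ) > 0, which is incompatible with ℓ_i(τ) > 0
(`not_lineFun_pos_neg_pos`). Once b > 0, x₋(τ) lies in some Ω_j, and j = i because no two of the ℓ's
are positive together in the hexagon (`lineFun_pos_unique`). -/

lemma plane_ext {v w : Plane} (h0 : v 0 = w 0) (h1 : v 1 = w 1) : v = w := by
  ext i; fin_cases i <;> assumption

lemma norm_sq_coord (v : Plane) : ‖v‖ ^ 2 = v 0 ^ 2 + v 1 ^ 2 := by
  simp [EuclideanSpace.norm_sq_eq, Fin.sum_univ_two]

lemma inner_coord (v w : Plane) : inner ℝ v w = v 0 * w 0 + v 1 * w 1 := by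
  simp [PiLp.inner_apply, Fin.sum_univ_two, mul_comm]

@[simp] lemma star_zero (v : Plane) : star v 0 = -v 1 := by simp [star]

@[simp] lemma star_one (v : Plane) : star v 1 = v 0 := by simp [star]

lemma eq_of_inner_eq {p q v w : Plane} (h : wedge p q ≠ 0)
    (hp : inner ℝ p v = inner ℝ p w) (hq : inner ℝ q v = inner ℝ q w) : v = w := by
  simp only [inner_coord] at hp hq
  unfold wedge at h
  apply plane_ext
  · apply mul_left_cancel₀ h
    linear_combination q 1 * hp - p 1 * hq
  · apply mul_left_cancel₀ h
    linear_combination p 0 * hq - q 0 * hp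

lemma wedge_smul_smul (s t : ℝ) (v w : Plane) :
    wedge (s • v) (t • w) = s * t * wedge v w := by
  simp [wedge]; ring

lemma norm_smul_unit (v : Plane) : ‖v‖ • unit v = v := by
  by_cases h : v = 0
  · simp [h]
  · rw [unit, smul_smul, mul_inv_cancel₀ (norm_ne_zero_iff.2 h), one_smul]

lemma unit_sq {v : Plane} (h : v ≠ 0) : unit v 0 ^ 2 + unit v 1 ^ 2 = 1 := by
  rw [← norm_sq_coord, unit, norm_smul, norm_inv, norm_norm,
    inv_mul_cancel₀ (norm_ne_zero_iff.2 h), one_pow]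

lemma wedge_eq_unit (v w : Plane) : wedge v w = ‖v‖ * ‖w‖ * wedge (unit v) (unit w) := by
  conv_lhs => rw [← norm_smul_unit v, ← norm_smul_unit w, wedge_smul_smul]

lemma wedge_pos_iff_unit {v w : Plane} (hv : v ≠ 0) (hw : w ≠ 0) :
    0 < wedge v w ↔ 0 < wedge (unit v) (unit w) := by
  have h : 0 < ‖v‖ * ‖w‖ := mul_pos (norm_pos_iff.2 hv) (norm_pos_iff.2 hw)
  rw [wedge_eq_unit, mul_pos_iff_of_pos_left h]

lemma wedge_swap (v w : Plane) : wedge v w = -wedge w v := by unfold wedge; ring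

end Plane

variable {m : Fin 3 → Plane}

/-! ### Fibres of the TDOA map as roots of a quadratic. -/

section Roots

/-- Since a = ‖v‖² - W², the quadratic vanishes at r exactly when ‖l₀ + r v‖² = W² r², the
light-cone condition. -/
lemma norm_sq_line (τ : Plane) (r : ℝ) :
    ‖lVec m τ + r • vVec m τ‖ ^ 2 = aPoly m τ * r ^ 2 + 2 * bPoly m τ * r + cPoly m τ
      + wedge (dd m 1 0) (dd m 2 0) ^ 2 * r ^ 2 := by
  rw [norm_add_sq_real, norm_smul, inner_smul_right, real_inner_comm, mul_pow, Real.norm_eq_abs,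
    sq_abs, aPoly, bPoly, cPoly]
  ring

lemma inner_dd10_line (h : wedge (dd m 1 0) (dd m 2 0) ≠ 0) (τ : Plane) (r : ℝ) :
    inner ℝ (dd m 1 0) (lVec m τ + r • vVec m τ) =
      (‖dd m 1 0‖ ^ 2 - τ 0 ^ 2) / 2 + r * wedge (dd m 1 0) (dd m 2 0) * τ 0 := by
  rw [inner_coord]
  simp only [lVec, vVec, PiLp.add_apply, PiLp.smul_apply, PiLp.sub_apply, star_zero, star_one,
    smul_eq_mul]
  field_simp
  unfold wedge
  ring

lemma inner_dd20_line (h : wedge (dd m 1 0) (dd m 2 0) ≠ 0) (τ : Plane) (r : ℝ) :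
    inner ℝ (dd m 2 0) (lVec m τ + r • vVec m τ) =
      (‖dd m 2 0‖ ^ 2 - τ 1 ^ 2) / 2 + r * wedge (dd m 1 0) (dd m 2 0) * τ 1 := by
  rw [inner_coord]
  simp only [lVec, vVec, PiLp.add_apply, PiLp.smul_apply, PiLp.sub_apply, star_zero, star_one,
    smul_eq_mul]
  field_simp
  unfold wedge
  ring

lemma cPoly_pos (h : wedge (dd m 1 0) (dd m 2 0) ≠ 0) {τ : Plane} (hτ : τ ∈ P2int m) :
    0 < cPoly m τ := by
  have h1 := inner_dd10_line h τ 0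
  rw [zero_smul, add_zero] at h1
  have h2 : lVec m τ ≠ 0 := by
    intro h0
    rw [h0, inner_zero_right] at h1
    have := hτ.1
    nlinarith
  exact pow_pos (norm_pos_iff.2 h2) 2

/-- The discriminant factors along the six sides of the hexagon, so the roots are real inside it. -/
lemma discrim_eq (h : wedge (dd m 1 0) (dd m 2 0) ≠ 0) (τ : Plane) :
    4 * (bPoly m τ ^ 2 - aPoly m τ * cPoly m τ) =
      (‖dd m 1 0‖ ^ 2 - τ 0 ^ 2) * (‖dd m 2 0‖ ^ 2 - τ 1 ^ 2) *
        (‖dd m 2 1‖ ^ 2 - (τ 1 - τ 0) ^ 2) := by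
  have h21 : ‖dd m 2 1‖ ^ 2
      = ‖dd m 2 0‖ ^ 2 + ‖dd m 1 0‖ ^ 2 - 2 * inner ℝ (dd m 1 0) (dd m 2 0) := by
    simp only [norm_sq_coord, inner_coord, dd, PiLp.sub_apply]; ring
  rw [h21]
  have hp := norm_sq_coord (dd m 1 0)
  have hq := norm_sq_coord (dd m 2 0)
  rw [bPoly, aPoly, cPoly, inner_coord, inner_coord, norm_sq_coord, norm_sq_coord]
  simp only [lVec, vVec, PiLp.smul_apply, PiLp.sub_apply, star_zero, star_one, smul_eq_mul]
  generalize ‖dd m 1 0‖ ^ 2 = P at *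
  generalize ‖dd m 2 0‖ ^ 2 = Q at *
  subst hp hq
  field_simp
  unfold wedge
  ring

lemma discrim_nonneg (h : wedge (dd m 1 0) (dd m 2 0) ≠ 0) {τ : Plane} (hτ : τ ∈ P2int m) :
    0 ≤ bPoly m τ ^ 2 - aPoly m τ * cPoly m τ := by
  have key := discrim_eq h τ
  obtain ⟨h1, h2, h3⟩ := hτ
  have h1 : 0 ≤ ‖dd m 1 0‖ ^ 2 - τ 0 ^ 2 := by nlinarith
  have h2 : 0 ≤ ‖dd m 2 0‖ ^ 2 - τ 1 ^ 2 := by nlinarith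
  have h3 : 0 ≤ ‖dd m 2 1‖ ^ 2 - (τ 1 - τ 0) ^ 2 := by nlinarith
  have := mul_nonneg (mul_nonneg h1 h2) h3
  linarith

lemma disp_eq_sub (j : Fin 3) (x : Plane) : disp m j x = disp m 0 x - dd m j 0 := by
  simp [disp, dd]

/-- The norm of `y - p` when `y` lies on both radical lines and the light cone. -/
lemma norm_sub_eq_of_inner {y p : Plane} {t : ℝ} (hp : inner ℝ p y = (‖p‖ ^ 2 - t ^ 2) / 2 - ‖y‖ * t)
    (ht : -‖p‖ < t) : ‖y - p‖ - ‖y‖ = t := by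
  have h1 : ‖y - p‖ ^ 2 = (‖y‖ + t) ^ 2 := by
    rw [norm_sub_sq_real, real_inner_comm, hp]; ring
  have h2 : ‖p‖ ≤ ‖y‖ + ‖y - p‖ := by
    rw [norm_sub_rev, add_comm]
    simpa using norm_add_le (p - y) y
  -- The opposite sign would give ‖y - p‖ + ‖y‖ = -t < ‖p‖, against the triangle inequality.
  rcases eq_or_eq_neg_of_sq_eq_sq _ _ h1 with h | h <;> linarith

lemma norm_disp_of_root (hm : 0 < wedge (dd m 1 0) (dd m 2 0)) {τ : Plane} {r : ℝ}
    (hr : r ≤ 0) (h : aPoly m τ * r ^ 2 + 2 * bPoly m τ * r + cPoly m τ = 0) :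
    ‖lVec m τ + r • vVec m τ‖ = -(r * wedge (dd m 1 0) (dd m 2 0)) := by
  have h1 : ‖lVec m τ + r • vVec m τ‖ ^ 2 = (-(r * wedge (dd m 1 0) (dd m 2 0))) ^ 2 := by
    rw [norm_sq_line, h]; ring
  have h2 : 0 ≤ -(r * wedge (dd m 1 0) (dd m 2 0)) := by nlinarith
  exact (pow_left_inj₀ (norm_nonneg _) h2 two_ne_zero).1 h1

lemma disp_zero_line (τ : Plane) (r : ℝ) :
    disp m 0 (m 0 + lVec m τ + r • vVec m τ) = lVec m τ + r • vVec m τ := by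
  simp [disp, add_assoc]

/-- The sign condition r ≤ 0 makes -r W equal to the norm of l₀ + r v; the points of the line then
satisfy the unsquared equations. -/
lemma tau2_of_root (hm : 0 < wedge (dd m 1 0) (dd m 2 0)) {τ : Plane} (hτ : τ ∈ P2int m) {r : ℝ}
    (hr : r ≤ 0) (h : aPoly m τ * r ^ 2 + 2 * bPoly m τ * r + cPoly m τ = 0) :
    tau2 m (m 0 + lVec m τ + r • vVec m τ) = τ := by
  have hn := norm_disp_of_root hm hr h
  have h1 := inner_dd10_line hm.ne' τ r
  have h2 := inner_dd20_line hm.ne' τ r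
  apply plane_ext
  · simp only [tau2, rangeDiff, disp_eq_sub (m := m) 1, disp_zero_line]
    exact norm_sub_eq_of_inner (by rw [h1, hn]; ring) hτ.1.1
  · simp only [tau2, rangeDiff, disp_eq_sub (m := m) 2, disp_zero_line]
    exact norm_sub_eq_of_inner (by rw [h2, hn]; ring) hτ.2.1.1

/-- Both sides have the same inner products with the independent vectors d₁₀ and d₂₀, by the
equations obtained from squaring the range differences. -/
lemma disp_eq_line (h : wedge (dd m 1 0) (dd m 2 0) ≠ 0) (x : Plane) :
    disp m 0 x = lVec m (tau2 m x)
      + (-‖disp m 0 x‖ / wedge (dd m 1 0) (dd m 2 0)) • vVec m (tau2 m x) := by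
  have key : ∀ j, inner ℝ (dd m j 0) (disp m 0 x)
      = (‖dd m j 0‖ ^ 2 - rangeDiff m j 0 x ^ 2) / 2 - ‖disp m 0 x‖ * rangeDiff m j 0 x := by
    intro j
    have h1 : ‖disp m j x‖ ^ 2 = ‖disp m 0 x‖ ^ 2 - 2 * inner ℝ (dd m j 0) (disp m 0 x)
        + ‖dd m j 0‖ ^ 2 := by
      rw [disp_eq_sub, norm_sub_sq_real, real_inner_comm]
    rw [rangeDiff]
    linear_combination h1 / 2
  apply eq_of_inner_eq h
  · rw [inner_dd10_line h, key]
    simp only [tau2]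
    field_simp
    simp only [Matrix.cons_val_zero]
    ring
  · rw [inner_dd20_line h, key]
    simp only [tau2]
    field_simp
    simp only [Matrix.cons_val_one, Matrix.cons_val_zero]
    ring

lemma root_of_tau2 (h : wedge (dd m 1 0) (dd m 2 0) ≠ 0) {x τ : Plane} (hτ : tau2 m x = τ) {r : ℝ}
    (hr : r = -‖disp m 0 x‖ / wedge (dd m 1 0) (dd m 2 0)) :
    x = m 0 + lVec m τ + r • vVec m τ ∧
      aPoly m τ * r ^ 2 + 2 * bPoly m τ * r + cPoly m τ = 0 := by
  have h1 := disp_eq_line h x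
  rw [hτ, ← hr] at h1
  refine ⟨?_, ?_⟩
  · rw [add_assoc, ← h1]; simp [disp]
  · have h2 := norm_sq_line (m := m) τ r
    rw [← h1] at h2
    have h3 : wedge (dd m 1 0) (dd m 2 0) * r = -‖disp m 0 x‖ := by rw [hr]; field_simp
    linear_combination -h2 - (wedge (dd m 1 0) (dd m 2 0) * r - ‖disp m 0 x‖) * h3

lemma unitWedge_mul_norms (x : Plane) :
    ‖disp m 0 x‖ * ‖disp m 1 x‖ * ‖disp m 2 x‖ * unitWedge m x =
      ‖disp m 2 x‖ * wedge (disp m 1 x) (disp m 0 x)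
        - ‖disp m 1 x‖ * wedge (disp m 2 x) (disp m 0 x)
        + ‖disp m 0 x‖ * wedge (disp m 2 x) (disp m 1 x) := by
  rw [wedge_eq_unit (disp m 1 x), wedge_eq_unit (disp m 2 x) (disp m 0 x),
    wedge_eq_unit (disp m 2 x) (disp m 1 x), unitWedge]
  ring

/-- Half the derivative of the quadratic at the root given by `x` is a multiple of the Jacobian. -/
lemma deriv_at_root (h : wedge (dd m 1 0) (dd m 2 0) ≠ 0) {x τ : Plane} (hτ : tau2 m x = τ) {r : ℝ}
    (hr : r = -‖disp m 0 x‖ / wedge (dd m 1 0) (dd m 2 0)) :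
    aPoly m τ * r + bPoly m τ
      = -(‖disp m 0 x‖ * ‖disp m 1 x‖ * ‖disp m 2 x‖ * unitWedge m x) := by
  have h1 := disp_eq_line h x
  rw [hτ, ← hr] at h1
  have h3 : wedge (dd m 1 0) (dd m 2 0) * r = -‖disp m 0 x‖ := by rw [hr]; field_simp
  -- As a = ‖v‖² - W², a r + b = ⟨v, l₀ + r v⟩ - W² r, and W r = -‖d₀(x)‖.
  have h2 : aPoly m τ * r + bPoly m τ = inner ℝ (vVec m τ) (disp m 0 x)
      + wedge (dd m 1 0) (dd m 2 0) * ‖disp m 0 x‖ := by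
    rw [h1, inner_add_right, inner_smul_right, real_inner_self_eq_norm_sq, ← h1, aPoly, bPoly]
    linear_combination -wedge (dd m 1 0) (dd m 2 0) * h3
  rw [h2, unitWedge_mul_norms, inner_coord, vVec, ← hτ]
  simp only [tau2, rangeDiff, star_zero, star_one, PiLp.sub_apply, PiLp.smul_apply, smul_eq_mul]
  generalize ‖disp m 0 x‖ = n0
  generalize ‖disp m 1 x‖ = n1
  generalize ‖disp m 2 x‖ = n2
  simp [wedge, dd, disp]
  ring

end Roots

/-! ### Signed area of a triangle inscribed in the unit circle. -/

section Circle

lemma wedge_sq_add_inner_sq (u v : Plane) :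
    wedge u v ^ 2 + inner ℝ u v ^ 2 = (u 0 ^ 2 + u 1 ^ 2) * (v 0 ^ 2 + v 1 ^ 2) := by
  rw [inner_coord, wedge]; ring

/-- Expanding v and w in the orthonormal basis u, ∗u turns v ∧ w into products of wedges and inner
products with u. The factors 1 - ⟨u, ·⟩ are nonnegative for unit vectors, so two wedges of equal
sign determine the sign of the sum. -/
lemma wedge_cyclic_sum {u : Plane} (v w : Plane) (hu : u 0 ^ 2 + u 1 ^ 2 = 1) :
    wedge u v + wedge v w + wedge w u =
      wedge u v * (1 - inner ℝ u w) + wedge w u * (1 - inner ℝ u v) := by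
  simp only [inner_coord, wedge]
  linear_combination -(v 0 * w 1 - v 1 * w 0) * hu

lemma inner_le_one {u v : Plane} (hu : u 0 ^ 2 + u 1 ^ 2 = 1) (hv : v 0 ^ 2 + v 1 ^ 2 = 1) :
    inner ℝ u v ≤ 1 := by
  rw [inner_coord]
  nlinarith [sq_nonneg (u 0 - v 0), sq_nonneg (u 1 - v 1)]

lemma inner_lt_one {u v : Plane} (hu : u 0 ^ 2 + u 1 ^ 2 = 1) (hv : v 0 ^ 2 + v 1 ^ 2 = 1)
    (h : wedge u v ≠ 0) : inner ℝ u v < 1 := by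
  refine lt_of_le_of_ne (inner_le_one hu hv) fun h1 => h ?_
  have := wedge_sq_add_inner_sq u v
  rw [h1, hu, hv] at this
  exact pow_eq_zero_iff two_ne_zero |>.1 (by linarith)

lemma eq_of_inner_eq_one {u v : Plane} (hu : u 0 ^ 2 + u 1 ^ 2 = 1) (hv : v 0 ^ 2 + v 1 ^ 2 = 1)
    (h : inner ℝ u v = 1) : u = v := by
  rw [inner_coord] at h
  apply plane_ext <;> nlinarith [sq_nonneg (u 0 - v 0), sq_nonneg (u 1 - v 1)]

lemma wedge_cyclic_sum_neg {u v w : Plane} (hu : u 0 ^ 2 + u 1 ^ 2 = 1)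
    (hv : v 0 ^ 2 + v 1 ^ 2 = 1) (hw : w 0 ^ 2 + w 1 ^ 2 = 1)
    (h1 : wedge u v < 0) (h2 : wedge w u < 0) :
    wedge u v + wedge v w + wedge w u < 0 := by
  rw [wedge_cyclic_sum v w hu]
  have h3 := inner_lt_one hu hv h1.ne
  have h4 := inner_le_one hu hw
  nlinarith [mul_pos_of_neg_of_neg h2 (sub_neg.2 h3),
    mul_nonneg_of_nonpos_of_nonpos h1.le (sub_nonpos.2 h4)]

lemma wedge_cyclic_sum_nonneg {u v w : Plane} (hu : u 0 ^ 2 + u 1 ^ 2 = 1)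
    (hv : v 0 ^ 2 + v 1 ^ 2 = 1) (hw : w 0 ^ 2 + w 1 ^ 2 = 1)
    (h1 : 0 ≤ wedge u v) (h2 : 0 ≤ wedge w u) :
    0 ≤ wedge u v + wedge v w + wedge w u := by
  rw [wedge_cyclic_sum v w hu]
  exact add_nonneg (mul_nonneg h1 (sub_nonneg.2 (inner_le_one hu hw)))
    (mul_nonneg h2 (sub_nonneg.2 (inner_le_one hu hv)))

/-- The squared area of a triangle inscribed in the unit circle. -/
lemma wedge_cyclic_sum_sq {u v w : Plane} (hu : u 0 ^ 2 + u 1 ^ 2 = 1)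
    (hv : v 0 ^ 2 + v 1 ^ 2 = 1) (hw : w 0 ^ 2 + w 1 ^ 2 = 1) :
    (wedge u v + wedge v w + wedge w u) ^ 2 =
      2 * (1 - inner ℝ u v) * (1 - inner ℝ v w) * (1 - inner ℝ w u) := by
  have h1 : wedge u v + wedge v w + wedge w u = wedge (v - u) (w - u) := by
    simp only [wedge, PiLp.sub_apply]; ring
  have h2 := wedge_sq_add_inner_sq (v - u) (w - u)
  have h3 : inner ℝ (v - u) (w - u) = inner ℝ v w - inner ℝ u v - inner ℝ w u + 1 := by
    simp only [inner_coord, PiLp.sub_apply]; linear_combination hu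
  have h4 : (v - u) 0 ^ 2 + (v - u) 1 ^ 2 = 2 - 2 * inner ℝ u v := by
    simp only [inner_coord, PiLp.sub_apply]; linear_combination hu + hv
  have h5 : (w - u) 0 ^ 2 + (w - u) 1 ^ 2 = 2 - 2 * inner ℝ w u := by
    simp only [inner_coord, PiLp.sub_apply]; linear_combination hu + hw
  -- The Gram determinant of three vectors in the plane vanishes.
  have h6 : (u 0 ^ 2 + u 1 ^ 2) * (v 0 ^ 2 + v 1 ^ 2) * (w 0 ^ 2 + w 1 ^ 2)
      + 2 * inner ℝ u v * inner ℝ v w * inner ℝ w u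
      - (u 0 ^ 2 + u 1 ^ 2) * inner ℝ v w ^ 2 - (v 0 ^ 2 + v 1 ^ 2) * inner ℝ w u ^ 2
      - (w 0 ^ 2 + w 1 ^ 2) * inner ℝ u v ^ 2 = 0 := by
    simp only [inner_coord]; ring
  rw [hu, hv, hw] at h6
  rw [h3, h4, h5] at h2
  rw [h1]
  linear_combination h2 + h6

end Circle

/-! ### Sign and zeros of the Jacobian, and the degeneracy locus. -/

section Jacobian

lemma disp_ne_zero {x : Plane} (hx : ∀ i, x ≠ m i) (i : Fin 3) : disp m i x ≠ 0 :=
  sub_ne_zero.2 (hx i)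

lemma unitWedge_eq_neg_sum (x : Plane) :
    unitWedge m x = -(wedge (unit (disp m 0 x)) (unit (disp m 1 x))
      + wedge (unit (disp m 1 x)) (unit (disp m 2 x))
      + wedge (unit (disp m 2 x)) (unit (disp m 0 x))) := by
  simp only [unitWedge, wedge]; ring

lemma wedge_disp_sum (x : Plane) :
    wedge (disp m 0 x) (disp m 1 x) + wedge (disp m 1 x) (disp m 2 x)
      + wedge (disp m 2 x) (disp m 0 x) = wedge (dd m 1 0) (dd m 2 0) := by
  simp only [wedge, disp, dd, PiLp.sub_apply]; ring

lemma ne_receiver_of_mem_OmegaI {x : Plane} {i : Fin 3} (hx : x ∈ OmegaI m i) (j : Fin 3) :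
    x ≠ m j := by
  rintro rfl
  fin_cases i <;> fin_cases j <;> simp [OmegaI, wedge, disp] at hx

/-- Each Ω_i says that two of the three wedges d̃₀ ∧ d̃₁, d̃₁ ∧ d̃₂, d̃₂ ∧ d̃₀ are negative. If no
such pair exists, two of them are nonnegative and the cyclic sum is nonnegative. -/
lemma unitWedge_pos_iff {x : Plane} (hx : ∀ i, x ≠ m i) :
    0 < unitWedge m x ↔ ∃ i, x ∈ OmegaI m i := by
  have d := disp_ne_zero hx
  have s := fun i => unit_sq (d i)
  have h01 := wedge_pos_iff_unit (d 1) (d 0)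
  have h12 := wedge_pos_iff_unit (d 2) (d 1)
  have h20 := wedge_pos_iff_unit (d 0) (d 2)
  rw [wedge_swap (unit (disp m 1 x))] at h01
  rw [wedge_swap (unit (disp m 2 x))] at h12
  rw [wedge_swap, wedge_swap (unit (disp m 0 x)), Left.neg_pos_iff] at h20
  simp only [Fin.exists_fin_succ, Fin.succ_zero_eq_one, Fin.exists_fin_zero,
    OmegaI, Set.mem_ofPred_eq, or_false, Fin.succ_one_eq_two, h01, h12, h20,
    unitWedge_eq_neg_sum, Left.neg_pos_iff]
  constructor
  · intro h
    by_contra! hc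
    rcases lt_or_ge (wedge (unit (disp m 0 x)) (unit (disp m 1 x))) 0 with h0 | h0
    · have h1 := hc.1 h0
      have h2 := hc.2.1 h0
      linarith [wedge_cyclic_sum_nonneg (s 2) (s 0) (s 1) h1 h2]
    · rcases lt_or_ge (wedge (unit (disp m 2 x)) (unit (disp m 0 x))) 0 with h1 | h1
      · linarith [wedge_cyclic_sum_nonneg (s 1) (s 2) (s 0) (hc.2.2 h1) h0]
      · linarith [wedge_cyclic_sum_nonneg (s 0) (s 1) (s 2) h0 h1]
  · rintro (⟨h1, h2⟩ | ⟨h1, h2⟩ | ⟨h1, h2⟩)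
    · exact wedge_cyclic_sum_neg (s 0) (s 1) (s 2) h1 h2
    · linarith [wedge_cyclic_sum_neg (s 1) (s 2) (s 0) h2 h1]
    · linarith [wedge_cyclic_sum_neg (s 2) (s 0) (s 1) h1 h2]

/-- An inscribed triangle has zero area only if two of its vertices coincide, by the product formula
`wedge_cyclic_sum_sq`. -/
lemma unitWedge_eq_zero_iff {x : Plane} (hx : ∀ i, x ≠ m i) :
    unitWedge m x = 0 ↔ ∃ i j, i ≠ j ∧ SameRay ℝ (disp m i x) (disp m j x) := by
  have d := disp_ne_zero hx
  have s := fun i => unit_sq (d i)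
  have ray : ∀ i j, SameRay ℝ (disp m i x) (disp m j x) ↔
      inner ℝ (unit (disp m i x)) (unit (disp m j x)) = 1 := by
    intro i j
    rw [sameRay_iff_inv_norm_smul_eq_of_ne (d i) (d j)]
    refine ⟨fun h => ?_, eq_of_inner_eq_one (s i) (s j)⟩
    rw [unit, unit, ← h, ← s i, inner_coord, unit]
    ring
  have key := wedge_cyclic_sum_sq (s 0) (s 1) (s 2)
  rw [unitWedge_eq_neg_sum, neg_eq_zero, ← sq_eq_zero_iff, key]
  constructor
  · intro h
    rcases mul_eq_zero.1 h with h | h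
    · rcases mul_eq_zero.1 h with h | h
      · exact ⟨0, 1, by decide, (ray _ _).2 (by linarith)⟩
      · exact ⟨1, 2, by decide, (ray _ _).2 (by linarith)⟩
    · exact ⟨2, 0, by decide, (ray _ _).2 (by linarith)⟩
  · rintro ⟨i, j, hij, h⟩
    have h' := h.symm
    rw [ray] at h h'
    fin_cases i <;> fin_cases j <;> simp_all

lemma mem_degeneracyLocus_iff (hinj : Function.Injective m) {x : Plane} :
    x ∈ degeneracyLocus m ↔ ∃ i j, i ≠ j ∧ SameRay ℝ (disp m i x) (disp m j x) := by
  constructor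
  · rintro ⟨i, j, hij, t, ht, rfl⟩
    refine ⟨i, j, hij, ?_⟩
    have h1 : disp m i (m i + t • (m i - m j)) = t • (m i - m j) := by simp [disp]
    have h2 : disp m j (m i + t • (m i - m j)) = (1 + t) • (m i - m j) := by
      rw [disp, add_smul, one_smul]; abel
    rw [h1, h2]
    exact (SameRay.sameRay_nonneg_smul_left _ ht).nonneg_smul_right (by linarith)
  · rintro ⟨i, j, hij, h⟩
    -- Both displacements are nonnegative multiples of their sum s, so m_i - m_j = (b - a) s. The
    -- sign of b - a tells from which receiver the half-line through x starts.
    obtain ⟨a, b, ha, hb, hab, h1, h2⟩ := h.exists_eq_smul_add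
    set s := disp m i x + disp m j x with hs
    have h3 : m i - m j = (b - a) • s := by
      rw [sub_smul, ← h1, ← h2]; simp [disp]
    have hne : m i - m j ≠ 0 := sub_ne_zero.2 (hinj.ne hij)
    rcases lt_trichotomy a b with hlt | heq | hlt
    · refine ⟨i, j, hij, a / (b - a), div_nonneg ha (by linarith), ?_⟩
      rw [h3, smul_smul, div_mul_cancel₀ _ (by linarith), ← h1]; simp [disp]
    · exact absurd (by rw [h3, heq, sub_self, zero_smul]) hne
    · refine ⟨j, i, hij.symm, b / (a - b), div_nonneg hb (by linarith), ?_⟩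
      rw [← neg_sub (m i), h3, ← neg_smul, neg_sub, smul_smul,
        div_mul_cancel₀ _ (by linarith), ← h2]; simp [disp]

lemma mem_degeneracyLocus_iff_unitWedge (hinj : Function.Injective m) {x : Plane} :
    x ∈ degeneracyLocus m ↔ (∃ i, x = m i) ∨ unitWedge m x = 0 := by
  by_cases hx : ∀ i, x ≠ m i
  · rw [mem_degeneracyLocus_iff hinj, unitWedge_eq_zero_iff hx]
    simp [hx]
  · push Not at hx
    simp only [hx, true_or, iff_true]
    obtain ⟨i, rfl⟩ := hx
    obtain ⟨j, hj⟩ := exists_ne i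
    exact ⟨i, j, hj.symm, 0, le_rfl, by simp⟩

lemma injective_of_wedge_ne_zero (h : wedge (dd m 1 0) (dd m 2 0) ≠ 0) : Function.Injective m := by
  intro i j hij
  by_contra hne
  apply h
  fin_cases i <;> fin_cases j <;> dsimp at hij <;> first
    | exact absurd rfl hne
    | (simp only [wedge, dd, PiLp.sub_apply, hij]; ring1)

/-- The reverse triangle inequality |‖d_j‖ - ‖d_i‖| ≤ ‖d_{ji}‖ is strict exactly when d_i and d_j
are not on a common ray. -/
lemma tau2_mem_P2int_iff (hinj : Function.Injective m) {x : Plane} :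
    tau2 m x ∈ P2int m ↔ x ∉ degeneracyLocus m := by
  have key : ∀ i j, (-‖dd m j i‖ < rangeDiff m j i x ∧ rangeDiff m j i x < ‖dd m j i‖) ↔
      ¬ SameRay ℝ (disp m i x) (disp m j x) := by
    intro i j
    have h : disp m i x - disp m j x = dd m j i := by simp [disp, dd]
    rw [← abs_lt, not_sameRay_iff_abs_lt_norm_sub, h, rangeDiff, abs_sub_comm]
  have h0 : tau2 m x 0 = rangeDiff m 1 0 x := rfl
  have h1 : tau2 m x 1 = rangeDiff m 2 0 x := rfl
  have h2 : rangeDiff m 2 0 x - rangeDiff m 1 0 x = rangeDiff m 2 1 x := by simp [rangeDiff]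
  rw [mem_degeneracyLocus_iff hinj, P2int, Set.mem_ofPred_eq, h0, h1, h2, key, key, key]
  push Not
  constructor
  · rintro ⟨h1, h2, h3⟩ i j hij
    have h1' := fun h => h1 (SameRay.symm h)
    have h2' := fun h => h2 (SameRay.symm h)
    have h3' := fun h => h3 (SameRay.symm h)
    fin_cases i <;> fin_cases j <;> first | assumption | exact absurd rfl hij
  · intro h
    exact ⟨h _ _ (by decide), h _ _ (by decide), h _ _ (by decide)⟩

lemma tau2_mem_P2 (x : Plane) : tau2 m x ∈ P2 m := by
  have key : ∀ i j, (-‖dd m j i‖ ≤ rangeDiff m j i x ∧ rangeDiff m j i x ≤ ‖dd m j i‖) := by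
    intro i j
    have h : disp m i x - disp m j x = dd m j i := by simp [disp, dd]
    rw [← abs_le, ← h, rangeDiff, abs_sub_comm]
    exact abs_norm_sub_norm_le _ _
  have h2 : rangeDiff m 2 0 x - rangeDiff m 1 0 x = rangeDiff m 2 1 x := by simp [rangeDiff]
  exact ⟨key 0 1, key 0 2, by simpa [tau2, h2] using key 1 2⟩

end Jacobian

/-! ### Interior of the hexagon, openness, density and disjointness. -/

section Topology

lemma interior_P2 : interior (P2 m) = P2int m := by
  -- The hexagon is an intersection of preimages of closed intervals under three open maps, and such
  -- preimages commute with interiors.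
  let f : Plane →L[ℝ] ℝ := EuclideanSpace.proj 1 - EuclideanSpace.proj 0
  have hf : ∀ τ, f τ = τ 1 - τ 0 := fun τ => rfl
  have hfo : IsOpenMap f := by
    apply ContinuousLinearMap.isOpenMap_of_ne_zero
    intro h
    have := congrArg (fun g : Plane →L[ℝ] ℝ => g !₂[0, 1]) h
    simp [hf] at this
  have h : P2 m = (fun τ : Plane => τ 0) ⁻¹' Set.Icc (-‖dd m 1 0‖) ‖dd m 1 0‖ ∩
      ((fun τ : Plane => τ 1) ⁻¹' Set.Icc (-‖dd m 2 0‖) ‖dd m 2 0‖ ∩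
        f ⁻¹' Set.Icc (-‖dd m 2 1‖) ‖dd m 2 1‖) := rfl
  rw [h, interior_inter, interior_inter,
    ← (PiLp.isOpenMap_apply 2 _ 0).preimage_interior_eq_interior_preimage (by fun_prop),
    ← (PiLp.isOpenMap_apply 2 _ 1).preimage_interior_eq_interior_preimage (by fun_prop),
    ← hfo.preimage_interior_eq_interior_preimage f.continuous,
    interior_Icc, interior_Icc, interior_Icc]
  rfl

lemma tau2_notMem_frontier_iff {x : Plane} : tau2 m x ∉ frontier (P2 m) ↔ tau2 m x ∈ P2int m := by
  rw [frontier, interior_P2, Set.mem_sdiff, not_and, not_not]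
  exact ⟨fun h => h (subset_closure (tau2_mem_P2 x)), fun h _ => h⟩

lemma dense_ne_line {w : Plane} (hw : w ≠ 0) (p : Plane) : Dense {x | wedge w (x - p) ≠ 0} := by
  have hne : innerSL ℝ (star w) ≠ 0 := by
    intro h
    have h1 := congrArg (fun g : Plane →L[ℝ] ℝ => g (star w)) h
    simp only [innerSL_apply_apply, inner_coord, star_zero, star_one,
      _root_.zero_apply] at h1
    exact hw (plane_ext (by simp; nlinarith) (by simp; nlinarith))
  have h1 : Dense (innerSL ℝ (star w) ⁻¹' {wedge w p}ᶜ) :=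
    (dense_compl_singleton _).preimage (ContinuousLinearMap.isOpenMap_of_ne_zero _ hne)
  convert h1 using 1
  ext x
  simp only [Set.mem_ofPred_eq, Set.mem_preimage, innerSL_apply_apply, Set.mem_compl_iff,
    Set.mem_singleton_iff, inner_coord, star_zero, star_one, wedge, PiLp.sub_apply]
  rw [not_iff_not]
  constructor <;> intro h <;> linarith

lemma isOpen_ne_line (w p : Plane) : IsOpen {x | wedge w (x - p) ≠ 0} := by
  refine isOpen_ne_fun ?_ continuous_const
  unfold wedge
  fun_prop

/-- The six half-lines lie on the three side lines of the triangle, and the complement of three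
lines is dense. -/
lemma dense_compl_degeneracyLocus (hinj : Function.Injective m) : Dense (degeneracyLocus m)ᶜ := by
  have hne : ∀ i j, i ≠ j → m i - m j ≠ 0 := fun i j h => sub_ne_zero.2 (hinj.ne h)
  refine ((dense_ne_line (hne 0 1 (by decide)) (m 0)).inter_of_isOpen_left
    ((dense_ne_line (hne 1 2 (by decide)) (m 1)).inter_of_isOpen_left
      (dense_ne_line (hne 2 0 (by decide)) (m 2)) (isOpen_ne_line _ _))
    (isOpen_ne_line _ _)).mono ?_
  rintro _ ⟨h1, h2, h3⟩ ⟨i, j, hij, t, -, rfl⟩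
  simp only [wedge, PiLp.sub_apply, PiLp.add_apply, PiLp.smul_apply, smul_eq_mul,
    Set.mem_ofPred_eq] at h1 h2 h3
  fin_cases i <;> fin_cases j <;> dsimp at h1 h2 h3 <;> first
    | exact absurd rfl hij
    | exact h1 (by ring1)
    | exact h2 (by ring1)
    | exact h3 (by ring1)

lemma continuous_disp (i : Fin 3) : Continuous (disp m i) := by
  unfold disp; fun_prop

lemma isOpen_OmegaI (i : Fin 3) : IsOpen (OmegaI m i) := by
  have h : ∀ i j, Continuous fun x => wedge (disp m i x) (disp m j x) := by
    intro i j
    unfold wedge disp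
    fun_prop
  fin_cases i
  · exact (isOpen_lt continuous_const (h 1 0)).inter (isOpen_lt (h 2 0) continuous_const)
  · exact (isOpen_lt continuous_const (h 1 0)).inter (isOpen_lt continuous_const (h 2 1))
  · exact (isOpen_lt (h 2 0) continuous_const).inter (isOpen_lt continuous_const (h 2 1))

lemma isOpen_Omega : IsOpen (Omega m) := by
  have ho : IsOpen {x | ∀ i, x ≠ m i} := by
    simp only [Set.ofPred_forall]
    exact isOpen_iInter_of_finite fun i => isOpen_ne
  have hu : ∀ i, ContinuousOn (fun x => unit (disp m i x)) {x | ∀ i, x ≠ m i} := fun i =>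
    ((continuous_disp i).norm.continuousOn.inv₀
      fun x hx => norm_ne_zero_iff.2 (disp_ne_zero hx i)).smul (continuous_disp i).continuousOn
  have hw : ∀ i j, ContinuousOn (fun x => wedge (unit (disp m i x)) (unit (disp m j x)))
      {x | ∀ i, x ≠ m i} := by
    intro i j
    have hc : ∀ i k, ContinuousOn (fun x => unit (disp m i x) k) {x | ∀ i, x ≠ m i} := fun i k =>
      (EuclideanSpace.proj k : Plane →L[ℝ] ℝ).continuous.comp_continuousOn (hu i)
    exact ((hc i 0).mul (hc j 1)).sub ((hc i 1).mul (hc j 0))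
  have hJ : ContinuousOn (unitWedge m) {x | ∀ i, x ≠ m i} :=
    ((hw 1 0).sub (hw 2 0)).add (hw 2 1)
  exact hJ.isOpen_inter_preimage ho isOpen_Iio

lemma disjoint_Omega_OmegaI (i : Fin 3) : Disjoint (Omega m) (OmegaI m i) :=
  Set.disjoint_left.2 fun _ hx hi => hx.2.not_gt ((unitWedge_pos_iff hx.1).2 ⟨i, hi⟩)

/-- The three cyclic wedges of the displacements add up to W > 0, while a point in two of the sets
would make all three negative. -/
lemma disjoint_OmegaI (hm : 0 < wedge (dd m 1 0) (dd m 2 0)) {i j : Fin 3} (hij : i ≠ j) :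
    Disjoint (OmegaI m i) (OmegaI m j) := by
  refine Set.disjoint_left.2 fun x hi hj => ?_
  have h := wedge_disp_sum (m := m) x
  rw [wedge_swap (disp m 0 x), wedge_swap (disp m 1 x) (disp m 2 x)] at h
  fin_cases i <;> fin_cases j <;> first
    | exact absurd rfl hij
    | (simp only [OmegaI, Set.mem_ofPred_eq] at hi hj
       linarith [hi.1, hi.2, hj.1, hj.2])

lemma mem_compl_degeneracyLocus_iff (hinj : Function.Injective m) {x : Plane} :
    x ∉ degeneracyLocus m ↔ x ∈ Omega m ∨ ∃ i, x ∈ OmegaI m i := by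
  rw [mem_degeneracyLocus_iff_unitWedge hinj]
  by_cases hx : ∀ i, x ≠ m i
  · rw [← unitWedge_pos_iff hx]
    have h1 : ¬ ∃ i, x = m i := fun ⟨i, hi⟩ => hx i hi
    have h2 : x ∈ Omega m ↔ unitWedge m x < 0 := ⟨fun h => h.2, fun h => ⟨hx, h⟩⟩
    rw [h2, or_iff_right h1, ← ne_eq, ne_iff_lt_or_gt]
  · have h1 : x ∉ Omega m := fun h => hx h.1
    have h2 : ¬ ∃ i, x ∈ OmegaI m i := fun ⟨i, hi⟩ => hx (ne_receiver_of_mem_OmegaI hi)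
    push Not at hx
    exact iff_of_false (not_not.2 (.inl hx)) (not_or.2 ⟨h1, h2⟩)

lemma compl_union_eq (hinj : Function.Injective m) :
    (Omega m ∪ ⋃ i, OmegaI m i)ᶜ = degeneracyLocus m := by
  ext x
  rw [← not_iff_not, mem_compl_degeneracyLocus_iff hinj, Set.mem_compl_iff, not_not, Set.mem_union,
    Set.mem_iUnion]

end Topology

/-! ### Derivative of the TDOA map and its rank. -/

section Derivative

lemma hasFDerivAt_norm_disp {x : Plane} {i : Fin 3} (hx : x ≠ m i) :
    HasFDerivAt (fun x => ‖disp m i x‖) (innerSL ℝ (unit (disp m i x))) x := by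
  have hd : HasFDerivAt (disp m i) (ContinuousLinearMap.id ℝ Plane) x :=
    (hasFDerivAt_id x).sub_const (m i)
  have hn : disp m i x ≠ 0 := sub_ne_zero.2 hx
  have h := hd.norm_sq.sqrt (pow_ne_zero 2 (norm_ne_zero_iff.2 hn))
  simp only [Real.sqrt_sq (norm_nonneg _)] at h
  refine h.congr_fderiv ?_
  refine ContinuousLinearMap.ext fun v => ?_
  have := norm_ne_zero_iff.2 hn
  simp [unit]
  field_simp

lemma hasFDerivAt_tau2 {x : Plane} (hx : ∀ i, x ≠ m i) :
    ∃ L : Plane →L[ℝ] Plane, HasFDerivAt (tau2 m) L x ∧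
      (∀ v, L v 0 = inner ℝ (unit (disp m 1 x) - unit (disp m 0 x)) v) ∧
      (∀ v, L v 1 = inner ℝ (unit (disp m 2 x) - unit (disp m 0 x)) v) := by
  have h1 := (hasFDerivAt_norm_disp (hx 1)).sub (hasFDerivAt_norm_disp (hx 0))
  have h2 := (hasFDerivAt_norm_disp (hx 2)).sub (hasFDerivAt_norm_disp (hx 0))
  let L : Plane →L[ℝ] Plane := (PiLp.continuousLinearEquiv 2 ℝ (fun _ : Fin 2 => ℝ)).symm ∘L
    ContinuousLinearMap.pi
      ![innerSL ℝ (unit (disp m 1 x)) - innerSL ℝ (unit (disp m 0 x)),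
        innerSL ℝ (unit (disp m 2 x)) - innerSL ℝ (unit (disp m 0 x))]
  refine ⟨L, ?_, fun v => ?_, fun v => ?_⟩
  · rw [← hasFDerivWithinAt_univ, hasFDerivWithinAt_euclidean]
    intro k
    rw [hasFDerivWithinAt_univ]
    fin_cases k
    · exact h1
    · exact h2
  · rw [inner_sub_left]; rfl
  · rw [inner_sub_left]; rfl

lemma differentiableAt_tau2 {x : Plane} (hx : ∀ i, x ≠ m i) : DifferentiableAt ℝ (tau2 m) x := by
  obtain ⟨L, hL, -⟩ := hasFDerivAt_tau2 hx
  exact hL.differentiableAt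

lemma finrank_range_fderiv_tau2_lt_iff {x : Plane} (hx : ∀ i, x ≠ m i) :
    Module.finrank ℝ (LinearMap.range (fderiv ℝ (tau2 m) x).toLinearMap) < 2 ↔
      unitWedge m x = 0 := by
  obtain ⟨L, hL, hL0, hL1⟩ := hasFDerivAt_tau2 hx
  rw [hL.fderiv]
  have hJ : wedge (unit (disp m 1 x) - unit (disp m 0 x)) (unit (disp m 2 x) - unit (disp m 0 x))
      = -unitWedge m x := by
    simp only [unitWedge, wedge, PiLp.sub_apply]; ring
  set e := unit (disp m 1 x) - unit (disp m 0 x)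
  set f := unit (disp m 2 x) - unit (disp m 0 x)
  have hrank := LinearMap.finrank_range_add_finrank_ker L.toLinearMap
  rw [finrank_euclideanSpace_fin] at hrank
  have hker : Module.finrank ℝ (LinearMap.ker L.toLinearMap) = 0 ↔ unitWedge m x ≠ 0 := by
    rw [Submodule.finrank_eq_zero, LinearMap.ker_eq_bot']
    constructor
    · intro h hz
      have hw : wedge e f = 0 := by rw [hJ, hz, neg_zero]
      have hs : ∀ v, inner ℝ e v = 0 → inner ℝ f v = 0 → v = 0 := fun v h1 h2 =>
        h v (plane_ext (by simpa [hL0] using h1) (by simpa [hL1] using h2))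
      simp only [inner_coord] at hs
      unfold wedge at hw
      -- When e ∧ f = 0, both ∗e and ∗f are orthogonal to e and f, hence in the kernel. A trivial
      -- kernel then forces e = f = 0, so every vector is in the kernel, a contradiction.
      have hse := hs (star e) (by simp only [star_zero, star_one]; ring)
        (by simp only [star_zero, star_one]; linarith)
      have hsf := hs (star f) (by simp only [star_zero, star_one]; linarith)
        (by simp only [star_zero, star_one]; ring)
      have he0 : e 0 = 0 := by simpa using congrArg (fun v : Plane => v 1) hse
      have he1 : e 1 = 0 := by simpa using congrArg (fun v : Plane => v 0) hse
      have hf0 : f 0 = 0 := by simpa using congrArg (fun v : Plane => v 1) hsf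
      have hf1 : f 1 = 0 := by simpa using congrArg (fun v : Plane => v 0) hsf
      have := hs !₂[1, 0] (by simp [he0]) (by simp [hf0])
      simpa using congrArg (fun v : Plane => v 0) this
    · intro h v hv
      have hv' : L v = 0 := hv
      refine eq_of_inner_eq (p := e) (q := f) (by rw [hJ]; exact neg_ne_zero.2 h) ?_ ?_
      · rw [← hL0, hv', inner_zero_right]; rfl
      · rw [← hL1, hv', inner_zero_right]; rfl
  rw [← not_iff_not, ← ne_eq (unitWedge m x), ← hker]
  omega

end Derivative

/-! ### The affine functions are positive on the images of the cones. -/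

section Lines

lemma lineFun_zero (τ : Plane) : lineFun m 0 τ = ‖dd m 2 0‖ * τ 0 + ‖dd m 1 0‖ * τ 1
    - (‖dd m 1 0‖ * ‖dd m 2 0‖ + inner ℝ (dd m 1 0) (dd m 2 0)) := by
  rw [lineFun, angleα, ← InnerProductGeometry.cos_angle_mul_norm_mul_norm]; ring

lemma lineFun_one (τ : Plane) : lineFun m 1 τ =
    -(‖dd m 1 0‖ + ‖dd m 2 1‖) * τ 0 + ‖dd m 1 0‖ * τ 1
    - (‖dd m 1 0‖ * ‖dd m 2 1‖ + inner ℝ (dd m 0 1) (dd m 2 1)) := by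
  have h : ‖dd m 0 1‖ = ‖dd m 1 0‖ := norm_sub_rev _ _
  rw [lineFun, angleβ, ← InnerProductGeometry.cos_angle_mul_norm_mul_norm, h]; ring

lemma lineFun_two (τ : Plane) : lineFun m 2 τ =
    ‖dd m 2 0‖ * τ 0 - (‖dd m 2 0‖ + ‖dd m 2 1‖) * τ 1
    - (‖dd m 2 0‖ * ‖dd m 2 1‖ + inner ℝ (dd m 0 2) (dd m 1 2)) := by
  have h : ‖dd m 0 2‖ = ‖dd m 2 0‖ := norm_sub_rev _ _
  have h' : ‖dd m 1 2‖ = ‖dd m 2 1‖ := norm_sub_rev _ _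
  rw [lineFun, angleγ, ← InnerProductGeometry.cos_angle_mul_norm_mul_norm, h, h']; ring

/-- In the open cone opposite to the one spanned by `p` and `q`, the range differences
lie beyond the chord of the tangency points. -/
lemma line_lt_of_opposite_cone {p q y : Plane} (hW : 0 < wedge p q) (hp : wedge p y < 0)
    (hq : 0 < wedge q y) :
    ‖p‖ * ‖q‖ + inner ℝ p q < ‖q‖ * (‖y - p‖ - ‖y‖) + ‖p‖ * (‖y - q‖ - ‖y‖) := by
  have hp0 : 0 < ‖p‖ := norm_pos_iff.2 (by rintro rfl; simp [wedge] at hW)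
  have hq0 : 0 < ‖q‖ := norm_pos_iff.2 (by rintro rfl; simp [wedge] at hW)
  have hy0 : 0 < ‖y‖ := norm_pos_iff.2 (by rintro rfl; simp [wedge] at hp)
  -- Cauchy–Schwarz bounds ‖y - z‖ - ‖y‖ below by -⟨z, y⟩ / ‖y‖. Taking z = p and z = q with weights
  -- ‖q‖ and ‖p‖ gives the lower bound (s‖p‖ + r‖q‖)(‖p‖‖q‖ + ⟨p, q⟩) / (W‖y‖), with s, r as below.
  have cs : ∀ z : Plane, ‖y‖ ^ 2 - inner ℝ z y ≤ ‖y - z‖ * ‖y‖ := fun z => by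
    rw [← real_inner_self_eq_norm_sq, ← inner_sub_left]; exact real_inner_le_norm _ _
  have hP := norm_sq_coord p
  have hQ := norm_sq_coord q
  have hY := norm_sq_coord y
  have c1 := cs p
  have c2 := cs q
  have hpq : inner ℝ p q < ‖p‖ * ‖q‖ := by
    refine abs_lt_of_sq_lt_sq' ?_ (by positivity) |>.2
    have := wedge_sq_add_inner_sq p q
    rw [← norm_sq_coord, ← norm_sq_coord] at this
    nlinarith
  have hpq' : -(‖p‖ * ‖q‖) < inner ℝ p q := by
    refine abs_lt_of_sq_lt_sq' ?_ (by positivity) |>.1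
    have := wedge_sq_add_inner_sq p q
    rw [← norm_sq_coord, ← norm_sq_coord] at this
    nlinarith
  set W := wedge p q with hWd
  set s := wedge q y with hs
  set r := -wedge p y with hr
  have hr0 : 0 < r := neg_pos.2 hp
  -- `W • y = -(s • p + r • q)`
  have e1 : W * inner ℝ p y = -(s * ‖p‖ ^ 2 + r * inner ℝ p q) := by
    rw [hP, hWd, hs, hr, inner_coord, inner_coord, wedge, wedge, wedge]; ring
  have e2 : W * inner ℝ q y = -(s * inner ℝ p q + r * ‖q‖ ^ 2) := by
    rw [hQ, hWd, hs, hr, inner_coord, inner_coord, wedge, wedge, wedge]; ring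
  have e3 : (W * ‖y‖) ^ 2 = (s * ‖p‖ + r * ‖q‖) ^ 2
      - 2 * s * r * (‖p‖ * ‖q‖ - inner ℝ p q) := by
    have : (W * ‖y‖) ^ 2 = s ^ 2 * ‖p‖ ^ 2 + 2 * s * r * inner ℝ p q + r ^ 2 * ‖q‖ ^ 2 := by
      rw [mul_pow, hY, hP, hQ, hWd, hs, hr, inner_coord, wedge, wedge, wedge]; ring
    rw [this]; ring
  -- The strict triangle inequality for W y = -(s p + r q).
  have e4 : W * ‖y‖ < s * ‖p‖ + r * ‖q‖ := by
    refine abs_lt_of_sq_lt_sq' ?_ (by positivity) |>.2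
    have := mul_pos (mul_pos hq hr0) (sub_pos.2 hpq)
    linarith
  have e5 := mul_lt_mul_of_pos_right e4 (sub_pos.2 hpq')
  have f1 := mul_le_mul_of_nonneg_left c1 (mul_pos hW hq0).le
  have f2 := mul_le_mul_of_nonneg_left c2 (mul_pos hW hp0).le
  have f3 : W * ‖y‖ * (‖p‖ * ‖q‖ + inner ℝ p q) <
      W * ‖y‖ * (‖q‖ * (‖y - p‖ - ‖y‖) + ‖p‖ * (‖y - q‖ - ‖y‖)) := by
    have g1 : W * ‖q‖ * (‖y‖ ^ 2 - inner ℝ p y)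
      = W * ‖q‖ * ‖y‖ ^ 2 + ‖q‖ * (s * ‖p‖ ^ 2 + r * inner ℝ p q) := by
        linear_combination -‖q‖ * e1
    have g2 : W * ‖p‖ * (‖y‖ ^ 2 - inner ℝ q y)
      = W * ‖p‖ * ‖y‖ ^ 2 + ‖p‖ * (s * inner ℝ p q + r * ‖q‖ ^ 2) := by
        linear_combination -‖p‖ * e2
    rw [g1] at f1
    rw [g2] at f2
    linarith
  exact lt_of_mul_lt_mul_left f3 (by positivity)

/-- Ω_i is the open cone at m_i opposite to the triangle, so the cone estimate applies with m_i as
origin. The triples below are cyclic, which preserves the orientation. -/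
lemma lineFun_tau2_pos (hm : 0 < wedge (dd m 1 0) (dd m 2 0)) {i : Fin 3} {x : Plane}
    (hx : x ∈ OmegaI m i) : 0 < lineFun m i (tau2 m x) := by
  have h0 : tau2 m x 0 = rangeDiff m 1 0 x := rfl
  have h1 : tau2 m x 1 = rangeDiff m 2 0 x := rfl
  have hd : ∀ i j, disp m j x - dd m i j = disp m i x := fun i j => by simp [disp, dd]
  have hn : ∀ i j, ‖dd m i j‖ = ‖dd m j i‖ := fun i j => norm_sub_rev _ _
  have key : ∀ i j k, 0 < wedge (dd m i k) (dd m j k) → 0 < wedge (disp m i x) (disp m k x) →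
      wedge (disp m j x) (disp m k x) < 0 →
      ‖dd m i k‖ * ‖dd m j k‖ + inner ℝ (dd m i k) (dd m j k) <
        ‖dd m j k‖ * rangeDiff m i k x + ‖dd m i k‖ * rangeDiff m j k x := by
    intro i j k hW hi hj
    have := line_lt_of_opposite_cone (y := disp m k x) hW
      (by simp only [wedge, disp, dd, PiLp.sub_apply] at *; linarith)
      (by simp only [wedge, disp, dd, PiLp.sub_apply] at *; linarith)
    rwa [hd, hd] at this
  fin_cases i
  · have := key 1 2 0 hm hx.1 hx.2
    simp only [Fin.zero_eta, lineFun_zero, h0, h1]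
    linarith
  · have := key 2 0 1 (by simp only [wedge, dd, PiLp.sub_apply] at *; linarith) hx.2
      (by rw [wedge_swap]; exact neg_lt_zero.2 hx.1)
    simp only [Fin.mk_one, lineFun_one, h0, h1]
    rw [hn 0 1, real_inner_comm] at this
    simp only [rangeDiff] at *
    linarith
  · have := key 0 1 2 (by simp only [wedge, dd, PiLp.sub_apply] at *; linarith)
      (by rw [wedge_swap]; exact neg_pos.2 hx.1)
      (by rw [wedge_swap]; exact neg_lt_zero.2 hx.2)
    simp only [Fin.reduceFinMk, lineFun_two, h0, h1]
    rw [hn 0 2, hn 1 2] at this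
    simp only [rangeDiff] at *
    linarith

end Lines

/-! ### Incompatibility of the three affine inequalities inside the hexagon. -/

section LineSeparation

/-- For a triangle with sides a, b, c this is 2abc times the sum of the cosines of the angles
opposite b and c, which is positive as the two angles add up to less than π. -/
lemma cos_sum_pos {a b c : ℝ} (hb : 0 < b) (hc : 0 < c) (h1 : b < a + c) (h2 : c < a + b) :
    0 < c * (a ^ 2 + b ^ 2 - c ^ 2) + b * (a ^ 2 + c ^ 2 - b ^ 2) := by
  have : c * (a ^ 2 + b ^ 2 - c ^ 2) + b * (a ^ 2 + c ^ 2 - b ^ 2)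
      = (b + c) * ((a + c - b) * (a + b - c)) := by ring
  rw [this]
  exact mul_pos (by positivity) (mul_pos (by linarith) (by linarith))

lemma norm_add_gt_of_wedge {u v : Plane} (h : wedge u v ≠ 0) : ‖u + v‖ < ‖u‖ + ‖v‖ := by
  refine lt_of_pow_lt_pow_left₀ 2 (by positivity) ?_
  have h1 : inner ℝ u v < ‖u‖ * ‖v‖ := by
    refine abs_lt_of_sq_lt_sq' ?_ (by positivity) |>.2
    have := wedge_sq_add_inner_sq u v
    rw [← norm_sq_coord, ← norm_sq_coord] at this
    have := pow_pos (abs_pos.2 h) 2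
    rw [sq_abs] at this
    nlinarith
  rw [norm_add_sq_real]
  nlinarith

/-- Side lengths and inner product of the triangle of receivers. -/
lemma triangle_relations (hm : 0 < wedge (dd m 1 0) (dd m 2 0)) :
    0 < ‖dd m 1 0‖ ∧ 0 < ‖dd m 2 0‖ ∧ 0 < ‖dd m 2 1‖ ∧
    ‖dd m 1 0‖ < ‖dd m 2 0‖ + ‖dd m 2 1‖ ∧ ‖dd m 2 0‖ < ‖dd m 1 0‖ + ‖dd m 2 1‖ ∧
    ‖dd m 2 1‖ < ‖dd m 1 0‖ + ‖dd m 2 0‖ ∧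
    2 * inner ℝ (dd m 1 0) (dd m 2 0) = ‖dd m 1 0‖ ^ 2 + ‖dd m 2 0‖ ^ 2 - ‖dd m 2 1‖ ^ 2 ∧
    2 * inner ℝ (dd m 0 1) (dd m 2 1) = ‖dd m 1 0‖ ^ 2 + ‖dd m 2 1‖ ^ 2 - ‖dd m 2 0‖ ^ 2 ∧
    2 * inner ℝ (dd m 0 2) (dd m 1 2) = ‖dd m 2 0‖ ^ 2 + ‖dd m 2 1‖ ^ 2 - ‖dd m 1 0‖ ^ 2 := by
  have hinj := injective_of_wedge_ne_zero hm.ne'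
  have hpos : ∀ i j, i ≠ j → 0 < ‖dd m i j‖ := fun i j h => norm_sub_pos_iff.2 (hinj.ne h)
  have hn : ∀ i j, ‖dd m i j‖ = ‖dd m j i‖ := fun i j => norm_sub_rev _ _
  have hadd : ∀ i j k, dd m i j + dd m j k = dd m i k := fun i j k => sub_add_sub_cancel _ _ _
  have htri : ∀ i j k, wedge (dd m i j) (dd m j k) ≠ 0 →
      ‖dd m i k‖ < ‖dd m i j‖ + ‖dd m j k‖ := fun i j k h => by
    rw [← hadd i j k]; exact norm_add_gt_of_wedge h
  refine ⟨hpos _ _ (by decide), hpos _ _ (by decide), hpos _ _ (by decide), ?_, ?_, ?_, ?_, ?_, ?_⟩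
  · rw [hn 2 1, add_comm]
    refine htri _ _ _ ?_
    simp only [wedge, dd, PiLp.sub_apply] at *
    linarith
  · rw [add_comm]
    refine htri _ _ _ ?_
    simp only [wedge, dd, PiLp.sub_apply] at *
    intro h
    linarith
  · rw [hn 1 0, add_comm]
    refine htri _ _ _ ?_
    simp only [wedge, dd, PiLp.sub_apply] at *
    intro h
    linarith
  all_goals
    simp only [norm_sq_coord, inner_coord, dd, PiLp.sub_apply]; ring

/-- Bounding one coordinate by its side of the hexagon leaves a bound on the other: τ₁₀ > ‖d₁₀‖ cos
α and τ₂₀ > ‖d₂₀‖ cos α. The next two lemmas do the same at the other receivers. -/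
lemma of_lineFun_zero_pos (hm : 0 < wedge (dd m 1 0) (dd m 2 0)) {τ : Plane} (hτ : τ ∈ P2int m)
    (h : 0 < lineFun m 0 τ) :
    inner ℝ (dd m 1 0) (dd m 2 0) < ‖dd m 2 0‖ * τ 0 ∧
      inner ℝ (dd m 1 0) (dd m 2 0) < ‖dd m 1 0‖ * τ 1 := by
  obtain ⟨p0, p1, p2, -⟩ := triangle_relations hm
  rw [lineFun_zero] at h
  have := mul_lt_mul_of_pos_left hτ.1.2 p1
  have := mul_lt_mul_of_pos_left hτ.2.1.2 p0
  constructor <;> linarith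

lemma of_lineFun_one_pos (hm : 0 < wedge (dd m 1 0) (dd m 2 0)) {τ : Plane} (hτ : τ ∈ P2int m)
    (h : 0 < lineFun m 1 τ) :
    inner ℝ (dd m 0 1) (dd m 2 1) < ‖dd m 2 1‖ * -τ 0 ∧
      inner ℝ (dd m 0 1) (dd m 2 1) < ‖dd m 1 0‖ * (τ 1 - τ 0) := by
  obtain ⟨p0, p1, p2, -⟩ := triangle_relations hm
  rw [lineFun_one] at h
  have := mul_lt_mul_of_pos_left hτ.1.1 p2
  have := mul_lt_mul_of_pos_left hτ.2.2.2 p0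
  constructor <;> linarith

lemma of_lineFun_two_pos (hm : 0 < wedge (dd m 1 0) (dd m 2 0)) {τ : Plane} (hτ : τ ∈ P2int m)
    (h : 0 < lineFun m 2 τ) :
    inner ℝ (dd m 0 2) (dd m 1 2) < ‖dd m 2 1‖ * -τ 1 ∧
      inner ℝ (dd m 0 2) (dd m 1 2) < ‖dd m 2 0‖ * (τ 0 - τ 1) := by
  obtain ⟨p0, p1, p2, -⟩ := triangle_relations hm
  rw [lineFun_two] at h
  have := mul_lt_mul_of_pos_left hτ.2.1.1 p2
  have := mul_lt_mul_of_pos_left hτ.2.2.1 p1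
  constructor <;> linarith

/-- If ℓ₀ and ℓ₁ were both positive, then ‖d₁₀‖ cos α < τ₁₀ < -‖d₁₀‖ cos β, against cos α + cos β >
0; the other pairs are alike. -/
lemma lineFun_pos_unique (hm : 0 < wedge (dd m 1 0) (dd m 2 0)) {τ : Plane} (hτ : τ ∈ P2int m)
    {i j : Fin 3} (hi : 0 < lineFun m i τ) (hj : 0 < lineFun m j τ) : i = j := by
  obtain ⟨p0, p1, p2, t0, t1, t2, g0, g1, g2⟩ := triangle_relations hm
  have n01 : 0 < lineFun m 0 τ → 0 < lineFun m 1 τ → False := fun h h' => by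
    have q := mul_lt_mul_of_pos_left (of_lineFun_zero_pos hm hτ h).1 p2
    have q' := mul_lt_mul_of_pos_left (of_lineFun_one_pos hm hτ h').1 p1
    have := cos_sum_pos (a := ‖dd m 1 0‖) p1 p2 (by linarith) (by linarith)
    rw [← g0, ← g1] at this
    linarith
  have n02 : 0 < lineFun m 0 τ → 0 < lineFun m 2 τ → False := fun h h' => by
    have q := mul_lt_mul_of_pos_left (of_lineFun_zero_pos hm hτ h).2 p2
    have q' := mul_lt_mul_of_pos_left (of_lineFun_two_pos hm hτ h').1 p0
    have := cos_sum_pos (a := ‖dd m 2 0‖) p0 p2 (by linarith) (by linarith)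
    rw [add_comm (‖dd m 2 0‖ ^ 2) (‖dd m 1 0‖ ^ 2), ← g0, ← g2] at this
    linarith
  have n12 : 0 < lineFun m 1 τ → 0 < lineFun m 2 τ → False := fun h h' => by
    have q := mul_lt_mul_of_pos_left (of_lineFun_one_pos hm hτ h).2 p1
    have q' := mul_lt_mul_of_pos_left (of_lineFun_two_pos hm hτ h').2 p0
    have := cos_sum_pos (a := ‖dd m 2 1‖) p0 p1 (by linarith) (by linarith)
    rw [add_comm (‖dd m 2 1‖ ^ 2) (‖dd m 1 0‖ ^ 2), add_comm (‖dd m 2 1‖ ^ 2) (‖dd m 2 0‖ ^ 2),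
      ← g1, ← g2] at this
    linarith
  fin_cases i <;> fin_cases j <;> first
    | rfl
    | exact (n01 hi hj).elim
    | exact (n01 hj hi).elim
    | exact (n02 hi hj).elim
    | exact (n02 hj hi).elim
    | exact (n12 hi hj).elim
    | exact (n12 hj hi).elim

lemma neg_mem_P2int {τ : Plane} (hτ : τ ∈ P2int m) : -τ ∈ P2int m := by
  obtain ⟨⟨h1, h2⟩, ⟨h3, h4⟩, h5, h6⟩ := hτ
  refine ⟨⟨?_, ?_⟩, ⟨?_, ?_⟩, ?_, ?_⟩ <;> simp only [PiLp.neg_apply] <;> linarith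

/-- For i ≠ j the two bounds add up to an excess over a side: ⟨d₁₀, d₂₀⟩ + ⟨d₀₁, d₂₁⟩ = ‖d₁₀‖² <
‖d₁₀‖ τ₁₀ when i = 0 and j = 1, against τ₁₀ < ‖d₁₀‖. For i = j the linear parts cancel and ℓ_i(τ) +
ℓ_i(-τ) is a negative constant, by the strict triangle inequality. -/
lemma not_lineFun_pos_neg_pos (hm : 0 < wedge (dd m 1 0) (dd m 2 0)) {τ : Plane}
    (hτ : τ ∈ P2int m) {i j : Fin 3} (hi : 0 < lineFun m i τ) (hj : 0 < lineFun m j (-τ)) :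
    False := by
  obtain ⟨p0, p1, p2, t0, t1, t2, g0, g1, g2⟩ := triangle_relations hm
  have n01 : ∀ τ ∈ P2int m, 0 < lineFun m 0 τ → 0 < lineFun m 1 (-τ) → False :=
    fun τ hτ h h' => by
      have q := (of_lineFun_zero_pos hm hτ h).2
      have q' := (of_lineFun_one_pos hm (neg_mem_P2int hτ) h').2
      have := mul_lt_mul_of_pos_left hτ.1.2 p0
      simp only [PiLp.neg_apply] at q'
      linarith
  have n02 : ∀ τ ∈ P2int m, 0 < lineFun m 0 τ → 0 < lineFun m 2 (-τ) → False :=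
    fun τ hτ h h' => by
      have q := (of_lineFun_zero_pos hm hτ h).1
      have q' := (of_lineFun_two_pos hm (neg_mem_P2int hτ) h').2
      have := mul_lt_mul_of_pos_left hτ.2.1.2 p1
      simp only [PiLp.neg_apply] at q'
      linarith
  have n12 : ∀ τ ∈ P2int m, 0 < lineFun m 1 τ → 0 < lineFun m 2 (-τ) → False :=
    fun τ hτ h h' => by
      have q := (of_lineFun_one_pos hm hτ h).1
      have q' := (of_lineFun_two_pos hm (neg_mem_P2int hτ) h').1
      have := mul_lt_mul_of_pos_left hτ.2.2.2 p2
      simp only [PiLp.neg_apply] at q'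
      linarith
  have n00 : ¬ (0 < lineFun m 0 τ ∧ 0 < lineFun m 0 (-τ)) := fun ⟨h, h'⟩ => by
    have := mul_pos (sub_pos.2 t2) (by positivity : 0 < ‖dd m 1 0‖ + ‖dd m 2 0‖ + ‖dd m 2 1‖)
    simp only [lineFun_zero, PiLp.neg_apply] at h h'
    linarith
  have n11 : ¬ (0 < lineFun m 1 τ ∧ 0 < lineFun m 1 (-τ)) := fun ⟨h, h'⟩ => by
    have := mul_pos (sub_pos.2 t1) (by positivity : 0 < ‖dd m 1 0‖ + ‖dd m 2 0‖ + ‖dd m 2 1‖)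
    simp only [lineFun_one, PiLp.neg_apply] at h h'
    linarith
  have n22 : ¬ (0 < lineFun m 2 τ ∧ 0 < lineFun m 2 (-τ)) := fun ⟨h, h'⟩ => by
    have := mul_pos (sub_pos.2 t0) (by positivity : 0 < ‖dd m 1 0‖ + ‖dd m 2 0‖ + ‖dd m 2 1‖)
    simp only [lineFun_two, PiLp.neg_apply] at h h'
    linarith
  have hτ' := neg_mem_P2int hτ
  have hi' := hi
  rw [← neg_neg τ] at hi'
  fin_cases i <;> fin_cases j <;> first
    | exact n00 ⟨hi, hj⟩
    | exact n11 ⟨hi, hj⟩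
    | exact n22 ⟨hi, hj⟩
    | exact n01 _ hτ hi hj
    | exact n02 _ hτ hi hj
    | exact n12 _ hτ hi hj
    | exact n01 _ hτ' hj hi'
    | exact n02 _ hτ' hj hi'
    | exact n12 _ hτ' hj hi'

end LineSeparation

/-! ### Inverse maps and images. -/

section Inversion

lemma vVec_neg (τ : Plane) : vVec m (-τ) = -vVec m τ := by
  apply plane_ext <;> simp [vVec] <;> ring

lemma lVec_neg (τ : Plane) : lVec m (-τ) = lVec m τ := by
  simp [lVec]

lemma aPoly_neg (τ : Plane) : aPoly m (-τ) = aPoly m τ := by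
  simp [aPoly, vVec_neg]

lemma bPoly_neg (τ : Plane) : bPoly m (-τ) = -bPoly m τ := by
  simp [bPoly, vVec_neg, lVec_neg]

lemma norms_pos {x : Plane} (hx : ∀ i, x ≠ m i) :
    0 < ‖disp m 0 x‖ * ‖disp m 1 x‖ * ‖disp m 2 x‖ := by
  have h := fun i => norm_pos_iff.2 (disp_ne_zero hx i)
  exact mul_pos (mul_pos (h 0) (h 1)) (h 2)

/-- The discriminant in terms of any root. -/
lemma discrim_of_root {τ : Plane} {r : ℝ}
    (h : aPoly m τ * r ^ 2 + 2 * bPoly m τ * r + cPoly m τ = 0) :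
    bPoly m τ ^ 2 - aPoly m τ * cPoly m τ = (aPoly m τ * r + bPoly m τ) ^ 2 := by
  linear_combination -aPoly m τ * h

lemma xPlus_tau2 (hm : 0 < wedge (dd m 1 0) (dd m 2 0)) {x : Plane} (hx : x ∈ Omega m) :
    xPlus m (tau2 m x) = x := by
  obtain ⟨h1, h2⟩ := root_of_tau2 hm.ne' (rfl : tau2 m x = _) rfl
  have h3 := deriv_at_root hm.ne' (rfl : tau2 m x = _) rfl
  have hpos := mul_neg_of_pos_of_neg (norms_pos hx.1) hx.2
  set r := -‖disp m 0 x‖ / wedge (dd m 1 0) (dd m 2 0)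
  set τ := tau2 m x
  have hd := discrim_of_root h2
  have h4 : 0 < aPoly m τ * r + bPoly m τ := by linarith
  have hr : lambdaPlus m τ = r := by
    rw [lambdaPlus]
    split_ifs with ha
    -- With a = 0 the derivative condition reads b > 0, so the linear equation determines r.
    · rw [ha] at h2 h4
      rw [div_eq_iff (by linarith)]
      linarith
    · rw [hd, Real.sqrt_sq h4.le, div_eq_iff ha]
      ring
  rw [xPlus, hr, ← h1]

lemma aPoly_pos_and_xMinus_tau2 (hm : 0 < wedge (dd m 1 0) (dd m 2 0)) {x : Plane} {i : Fin 3}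
    (hx : x ∈ OmegaI m i) : 0 < aPoly m (tau2 m x) ∧ xMinus m (tau2 m x) = x := by
  have hne := ne_receiver_of_mem_OmegaI hx
  obtain ⟨h1, h2⟩ := root_of_tau2 hm.ne' (rfl : tau2 m x = _) rfl
  have h3 := deriv_at_root hm.ne' (rfl : tau2 m x = _) rfl
  have hpos := mul_pos (norms_pos hne) ((unitWedge_pos_iff hne).2 ⟨i, hx⟩)
  have hr0 : -‖disp m 0 x‖ / wedge (dd m 1 0) (dd m 2 0) < 0 :=
    div_neg_of_neg_of_pos (neg_lt_zero.2 (norm_pos_iff.2 (disp_ne_zero hne 0))) hm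
  set r := -‖disp m 0 x‖ / wedge (dd m 1 0) (dd m 2 0)
  set τ := tau2 m x
  have hd := discrim_of_root h2
  have h4 : aPoly m τ * r + bPoly m τ < 0 := by linarith
  -- From the equation for r, a r² = 2 r (a r + b) + c, a positive term plus a nonnegative one.
  have ha : 0 < aPoly m τ := by
    have hc : 0 ≤ cPoly m τ := sq_nonneg _
    have := mul_pos_of_neg_of_neg hr0 h4
    refine pos_of_mul_pos_left (b := r ^ 2) ?_ (sq_nonneg r)
    linarith
  refine ⟨ha, ?_⟩
  have hr : lambdaMinus m τ = r := by
    rw [lambdaMinus, hd, Real.sqrt_sq_eq_abs, abs_of_neg h4, div_eq_iff ha.ne']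
    ring
  rw [xMinus, hr, ← h1]

/-- The point given by a nonpositive root, with its range differences and the sign of the
Jacobian there. -/
lemma point_of_root (hm : 0 < wedge (dd m 1 0) (dd m 2 0)) {τ : Plane} (hτ : τ ∈ P2int m) {r : ℝ}
    (hr : r ≤ 0) (h : aPoly m τ * r ^ 2 + 2 * bPoly m τ * r + cPoly m τ = 0) :
    tau2 m (m 0 + lVec m τ + r • vVec m τ) = τ ∧
      (0 < aPoly m τ * r + bPoly m τ → m 0 + lVec m τ + r • vVec m τ ∈ Omega m) ∧
      (aPoly m τ * r + bPoly m τ ≤ 0 → ∃ i, m 0 + lVec m τ + r • vVec m τ ∈ OmegaI m i) := by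
  have h1 := tau2_of_root hm hτ hr h
  have hn := norm_disp_of_root hm hr h
  rw [← disp_zero_line] at hn
  set x := m 0 + lVec m τ + r • vVec m τ
  have hd := deriv_at_root hm.ne' h1 (r := r) (by rw [hn]; field_simp)
  have hinj := injective_of_wedge_ne_zero hm.ne'
  have hD := (tau2_mem_P2int_iff hinj).1 (h1 ▸ hτ)
  refine ⟨h1, fun hp => ?_, fun hp => ?_⟩ <;>
    rcases (mem_compl_degeneracyLocus_iff hinj).1 hD with hx | ⟨i, hx⟩
  · exact hx
  · have hne := ne_receiver_of_mem_OmegaI hx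
    have := mul_pos (norms_pos hne) ((unitWedge_pos_iff hne).2 ⟨i, hx⟩)
    linarith
  · have := mul_neg_of_pos_of_neg (norms_pos hx.1) hx.2
    linarith
  · exact ⟨i, hx⟩

/-- For a, b > 0 the root λ₋ is nonpositive, and half the derivative there is -√(b² - a c) ≤ 0,
which selects the side J > 0. -/
lemma xMinus_mem (hm : 0 < wedge (dd m 1 0) (dd m 2 0)) {τ : Plane} (hτ : τ ∈ P2int m)
    (ha : 0 < aPoly m τ) (hb : 0 < bPoly m τ) :
    tau2 m (xMinus m τ) = τ ∧ ∃ i, xMinus m τ ∈ OmegaI m i := by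
  have hd := Real.sq_sqrt (discrim_nonneg hm.ne' hτ)
  have hs := Real.sqrt_nonneg (bPoly m τ ^ 2 - aPoly m τ * cPoly m τ)
  have hr : aPoly m τ * lambdaMinus m τ + bPoly m τ
      = -√(bPoly m τ ^ 2 - aPoly m τ * cPoly m τ) := by
    rw [lambdaMinus]; field_simp; ring
  have hneg : lambdaMinus m τ ≤ 0 := by
    rw [lambdaMinus]; exact div_nonpos_of_nonpos_of_nonneg (by linarith) ha.le
  have hroot : aPoly m τ * lambdaMinus m τ ^ 2 + 2 * bPoly m τ * lambdaMinus m τ + cPoly m τ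
      = 0 := by
    apply mul_left_cancel₀ ha.ne'
    linear_combination hd + (aPoly m τ * lambdaMinus m τ + bPoly m τ
      - √(bPoly m τ ^ 2 - aPoly m τ * cPoly m τ)) * hr
  obtain ⟨h1, -, h3⟩ := point_of_root hm hτ hneg hroot
  exact ⟨h1, h3 (by linarith)⟩

/-- The reflection τ ↦ -τ keeps a and changes the sign of b. If b < 0, it would therefore produce a
point of some Ω_j above -τ, excluded by the affine inequalities; b = 0 would make the discriminant
negative. -/
lemma bPoly_pos_of_mem_U (hm : 0 < wedge (dd m 1 0) (dd m 2 0)) {τ : Plane} {i : Fin 3}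
    (hτ : τ ∈ U m i) : 0 < bPoly m τ := by
  obtain ⟨hP, ha, hl⟩ := hτ
  rcases lt_trichotomy (bPoly m τ) 0 with hb | hb | hb
  · exfalso
    obtain ⟨h1, j, hj⟩ := xMinus_mem hm (neg_mem_P2int hP) (by rwa [aPoly_neg])
      (by rw [bPoly_neg]; linarith)
    have h2 := lineFun_tau2_pos hm hj
    rw [h1] at h2
    exact not_lineFun_pos_neg_pos hm hP hl h2
  · have h1 := discrim_nonneg hm.ne' hP
    have h2 := mul_pos ha (cPoly_pos hm.ne' hP)
    rw [hb] at h1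
    linarith
  · exact hb

lemma xMinus_mem_OmegaI (hm : 0 < wedge (dd m 1 0) (dd m 2 0)) {τ : Plane} {i : Fin 3}
    (hτ : τ ∈ U m i) : tau2 m (xMinus m τ) = τ ∧ xMinus m τ ∈ OmegaI m i := by
  obtain ⟨h1, j, hj⟩ := xMinus_mem hm hτ.1 hτ.2.1 (bPoly_pos_of_mem_U hm hτ)
  have h2 := lineFun_tau2_pos hm hj
  rw [h1] at h2
  rw [lineFun_pos_unique hm hτ.1 hτ.2.2 h2]
  exact ⟨h1, hj⟩

/-- A point of some `Ω_i` has a companion in `Ω` with the same range differences. -/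
lemma exists_mem_Omega_tau2_eq (hm : 0 < wedge (dd m 1 0) (dd m 2 0)) {x : Plane} {i : Fin 3}
    (hx : x ∈ OmegaI m i) : ∃ y ∈ Omega m, tau2 m y = tau2 m x := by
  have hinj := injective_of_wedge_ne_zero hm.ne'
  have hne := ne_receiver_of_mem_OmegaI hx
  have hP := (tau2_mem_P2int_iff hinj).2 ((mem_compl_degeneracyLocus_iff hinj).2 (.inr ⟨i, hx⟩))
  have ha := (aPoly_pos_and_xMinus_tau2 hm hx).1
  obtain ⟨h1, h2⟩ := root_of_tau2 hm.ne' (rfl : tau2 m x = _) rfl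
  have h3 := deriv_at_root hm.ne' (rfl : tau2 m x = _) rfl
  have hpos := mul_pos (norms_pos hne) ((unitWedge_pos_iff hne).2 ⟨i, hx⟩)
  have hr0 : -‖disp m 0 x‖ / wedge (dd m 1 0) (dd m 2 0) < 0 :=
    div_neg_of_neg_of_pos (neg_lt_zero.2 (norm_pos_iff.2 (disp_ne_zero hne 0))) hm
  set r := -‖disp m 0 x‖ / wedge (dd m 1 0) (dd m 2 0)
  set τ := tau2 m x
  have hc := cPoly_pos hm.ne' hP
  -- The other root, from the sum of the roots. The product c / a is positive, so s is negative like
  -- r, and a s + b = -(a r + b) > 0 places its point in Ω.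
  obtain ⟨s, hs⟩ : ∃ s, aPoly m τ * s = -2 * bPoly m τ - aPoly m τ * r :=
    ⟨(-2 * bPoly m τ - aPoly m τ * r) / aPoly m τ, by field_simp⟩
  have hprod : aPoly m τ * s * r = cPoly m τ := by rw [hs]; linear_combination -h2
  have hs0 : s < 0 := by
    by_contra! h
    have := mul_nonneg (mul_nonneg ha.le h) (neg_nonneg.2 hr0.le)
    linarith
  have hroot : aPoly m τ * s ^ 2 + 2 * bPoly m τ * s + cPoly m τ = 0 := by
    linear_combination s * hs - hprod
  obtain ⟨e1, e2, -⟩ := point_of_root hm hP hs0.le hroot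
  exact ⟨_, e2 (by linarith), e1⟩

lemma image_Omega (hm : 0 < wedge (dd m 1 0) (dd m 2 0)) :
    tau2 m '' Omega m = Set.range (tau2 m) \ frontier (P2 m) := by
  have hinj := injective_of_wedge_ne_zero hm.ne'
  ext τ
  constructor
  · rintro ⟨x, hx, rfl⟩
    exact ⟨⟨x, rfl⟩, tau2_notMem_frontier_iff.2 ((tau2_mem_P2int_iff hinj).2
      ((mem_compl_degeneracyLocus_iff hinj).2 (.inl hx)))⟩
  · rintro ⟨⟨x, rfl⟩, hx⟩
    rcases (mem_compl_degeneracyLocus_iff hinj).1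
      ((tau2_mem_P2int_iff hinj).1 (tau2_notMem_frontier_iff.1 hx)) with h | ⟨i, h⟩
    · exact ⟨x, h, rfl⟩
    · exact exists_mem_Omega_tau2_eq hm h

lemma image_OmegaI (hm : 0 < wedge (dd m 1 0) (dd m 2 0)) (i : Fin 3) :
    tau2 m '' OmegaI m i = U m i := by
  have hinj := injective_of_wedge_ne_zero hm.ne'
  ext τ
  constructor
  · rintro ⟨x, hx, rfl⟩
    exact ⟨(tau2_mem_P2int_iff hinj).2 ((mem_compl_degeneracyLocus_iff hinj).2 (.inr ⟨i, hx⟩)),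
      (aPoly_pos_and_xMinus_tau2 hm hx).1, lineFun_tau2_pos hm hx⟩
  · intro hτ
    exact ⟨xMinus m τ, (xMinus_mem_OmegaI hm hτ).2, (xMinus_mem_OmegaI hm hτ).1⟩

lemma degeneracyLocus_eq_rank (hinj : Function.Injective m) :
    degeneracyLocus m = {x | (∃ i, x = m i) ∨
      Module.finrank ℝ (LinearMap.range (fderiv ℝ (tau2 m) x).toLinearMap) < 2} := by
  ext x
  rw [mem_degeneracyLocus_iff_unitWedge hinj, Set.mem_ofPred_eq]
  by_cases hx : ∃ i, x = m i
  · simp [hx]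
  · rw [finrank_range_fderiv_tau2_lt_iff (not_exists.1 hx)]

end Inversion

end TDOA

theorem mainTheorem2 (m : Fin 3 → TDOA.Plane)
    (hm : 0 < TDOA.wedge (TDOA.dd m 1 0) (TDOA.dd m 2 0)) :
    -- the four sets are open, pairwise disjoint, and their union is dense
    (IsOpen (TDOA.Omega m) ∧ (∀ i, IsOpen (TDOA.OmegaI m i)) ∧
      (∀ i, Disjoint (TDOA.Omega m) (TDOA.OmegaI m i)) ∧
      (∀ i j, i ≠ j → Disjoint (TDOA.OmegaI m i) (TDOA.OmegaI m j)) ∧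
      Dense (TDOA.Omega m ∪ ⋃ i, TDOA.OmegaI m i)) ∧
    -- the complement of the union is the degeneracy locus, which consists of the receivers and
    -- of the points where the rank of the Jacobian drops, i.e. where the Jacobian vanishes
    ((TDOA.Omega m ∪ ⋃ i, TDOA.OmegaI m i)ᶜ = TDOA.degeneracyLocus m ∧
      TDOA.degeneracyLocus m = {x | (∃ i, x = m i) ∨
        Module.finrank ℝ (LinearMap.range (fderiv ℝ (TDOA.tau2 m) x).toLinearMap) < 2} ∧
      TDOA.degeneracyLocus m = {x | (∃ i, x = m i) ∨ TDOA.unitWedge m x = 0}) ∧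
    -- the restriction of the TDOA map to each set is differentiable and injective
    (DifferentiableOn ℝ (TDOA.tau2 m) (TDOA.Omega m) ∧
      Set.InjOn (TDOA.tau2 m) (TDOA.Omega m) ∧
      ∀ i, DifferentiableOn ℝ (TDOA.tau2 m) (TDOA.OmegaI m i) ∧
        Set.InjOn (TDOA.tau2 m) (TDOA.OmegaI m i)) ∧
    -- the images
    (TDOA.tau2 m '' TDOA.Omega m = Set.range (TDOA.tau2 m) \ frontier (TDOA.P2 m) ∧
      ∀ i, TDOA.tau2 m '' TDOA.OmegaI m i = TDOA.U m i) ∧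
    -- the inverse maps
    (Set.InvOn (TDOA.xPlus m) (TDOA.tau2 m) (TDOA.Omega m)
        (Set.range (TDOA.tau2 m) \ frontier (TDOA.P2 m)) ∧
      ∀ i, Set.InvOn (TDOA.xMinus m) (TDOA.tau2 m) (TDOA.OmegaI m i) (TDOA.U m i)) := by
  have hinj := TDOA.injective_of_wedge_ne_zero hm.ne'
  have leftO : Set.LeftInvOn (TDOA.xPlus m) (TDOA.tau2 m) (TDOA.Omega m) :=
    fun _ hx => TDOA.xPlus_tau2 hm hx
  have leftI : ∀ i, Set.LeftInvOn (TDOA.xMinus m) (TDOA.tau2 m) (TDOA.OmegaI m i) :=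
    fun i _ hx => (TDOA.aPoly_pos_and_xMinus_tau2 hm hx).2
  refine ⟨⟨TDOA.isOpen_Omega, TDOA.isOpen_OmegaI, TDOA.disjoint_Omega_OmegaI,
    fun i j hij => TDOA.disjoint_OmegaI hm hij, ?_⟩,
    ⟨TDOA.compl_union_eq hinj, TDOA.degeneracyLocus_eq_rank hinj,
      Set.ext fun x => TDOA.mem_degeneracyLocus_iff_unitWedge hinj⟩,
    ⟨fun x hx => (TDOA.differentiableAt_tau2 hx.1).differentiableWithinAt, leftO.injOn,
      fun i => ⟨fun x hx => (TDOA.differentiableAt_tau2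
        (TDOA.ne_receiver_of_mem_OmegaI hx)).differentiableWithinAt, (leftI i).injOn⟩⟩,
    ⟨TDOA.image_Omega hm, TDOA.image_OmegaI hm⟩, ⟨leftO, ?_⟩, fun i => ⟨leftI i, ?_⟩⟩
  · rw [← compl_compl (TDOA.Omega m ∪ _), TDOA.compl_union_eq hinj]
    exact TDOA.dense_compl_degeneracyLocus hinj
  · rw [← TDOA.image_Omega hm]
    rintro _ ⟨x, hx, rfl⟩
    rw [leftO hx]
  · exact fun τ hτ => (TDOA.xMinus_mem_OmegaI hm hτ).1
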